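/- **Series for the Riemann–Liouville fractional derivative.** For $\beta\in\mathbb C$ with $\operatorname{Re}\beta>0$ put $${}_0I_y^{\beta}f(y)=\frac1{\Gamma(\beta)}\int_0^y f(t)\,(y-t)^{\beta-1}\,dt ,\qquad\text{and}\qquad {}_0I_y^{0}f(y)=f(y).$$ For $\alpha\in\mathbb C$ let $n=n(\alpha)$ be the least integer $n\ge 0$ with $n=\alpha$ or $\operatorname{Re}(n-\alpha)>0$ (so for real $\alpha$: $n=\lceil\alpha\rceil$ if $\alpha>0$, and $n=0$ if $\alpha\le 0$), and put $${}_0D_x^{\alpha}f(x)=\frac{d^{n}}{dx^{n}}\,{}_0I_x^{\,n-\alpha}f(x).$$ Let $c_k=\binom{\alpha}{k}\frac{1}{\Gamma(k-\alpha+1)}$, where $1/\Gamma$ is $0$ at the poles of $\Gamma$. Let $\alpha\in\mathbb C$, $0<x<b$, and let $f$ be a complex-valued $C^\infty$ function on $(0,b)$. Suppose that 1. for some $\rho>0$ (for instance $\rho=1$), $\displaystyle\lim_{k\to\infty}\binom{\alpha}{k}\frac{\rho^{k}f^{(k)}(t)}{\Gamma(k+1-\alpha)}=0$ for every $t\in(0,x]$;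 2. the terms $c_k\,x^{k-\alpha}f^{(k)}(x)$ tend to $0$ as $k\to\infty$ (this follows from 1 if $x\le\rho$). Then ${}_0D_x^{\alpha}f(x)$ exists, in the sense that, if $\alpha\neq n$, the integral defining ${}_0I_y^{\,n-\alpha}f(y)$ converges absolutely for all $y$ near $x$, and that (in every case) the function $y\mapsto{}_0I_y^{\,n-\alpha}f(y)$ is $n$ times continuously differentiable at $x$. Moreover the series below converges (as the limit of its partial sums) and $${}_0D_x^{\alpha}f(x)=\sum_{k=0}^{\infty}\binom{\alpha}{k}\frac{x^{k-\alpha}}{\Gamma(k-\alpha+1)}\,f^{(k)}(x).$$ -/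

import Mathlib

open Filter Topology
open scoped ContDiff

/-- The Riemann–Liouville integral `₀I_y^β f (y)` with base point `0`:
`(1 / Γ(β)) ∫₀^y f(t) (y - t)^(β - 1) dt`, and the identity for `β = 0`.
It is used for `β = 0` and for `0 < Re β`. -/
noncomputable def rlIntegral (β : ℂ) (f : ℝ → ℂ) (y : ℝ) : ℂ :=
  if β = 0 then f y
  else (1 / Complex.Gamma β) * ∫ t in (0 : ℝ)..y, f t * ((y - t : ℝ) : ℂ) ^ (β - 1)

/-- The number `n` of ordinary derivatives in the Riemann–Liouville derivative of order `α`.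
For real `α` it is `0` if `α ≤ 0` and `⌈α⌉` if `0 < α`. For non-real `α` it is `0` if `Re α < 0`
and `⌊Re α⌋ + 1` if `0 ≤ Re α`. Thus it is the least natural number `n` for which
`n - α = 0` or `0 < Re (n - α)`. -/
noncomputable def rlOrder (α : ℂ) : ℕ :=
  if α.im = 0 then ⌈α.re⌉₊ else if α.re < 0 then 0 else ⌊α.re⌋₊ + 1

/-- The Riemann–Liouville derivative `₀D_x^α f (x) = dⁿ/dxⁿ ₀I_x^(n - α) f (x)`, `n = rlOrder α`.
For `n = 0` it is `₀I_x^(-α) f (x)`, and for `α = 0` it is `f x`. -/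
noncomputable def rlDeriv (α : ℂ) (f : ℝ → ℂ) (x : ℝ) : ℂ :=
  iteratedDeriv (rlOrder α) (rlIntegral ((rlOrder α : ℂ) - α) f) x

/-- The Riemann–Liouville derivative of order `α` of `f` exists at `x`: near `x` the fractional
integral that defines it converges absolutely, and it is `n` times continuously differentiable
at `x`. -/
def RLDifferentiableAt (α : ℂ) (f : ℝ → ℂ) (x : ℝ) : Prop :=
  ((rlOrder α : ℂ) - α ≠ 0 → ∀ᶠ y in 𝓝 x,
    IntervalIntegrable
      (fun t : ℝ => f t * ((y - t : ℝ) : ℂ) ^ ((rlOrder α : ℂ) - α - 1)) MeasureTheory.volume 0 y) ∧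
  ContDiffAt ℝ (rlOrder α) (rlIntegral ((rlOrder α : ℂ) - α) f) x

/-- The coefficient `binom(α, k) / Γ(k - α + 1)`. Since `Complex.Gamma` is `0` at its poles,
the quotient is `0` there, in agreement with the entire function `1 / Γ`. -/
noncomputable def rlCoeff (α : ℂ) (k : ℕ) : ℂ :=
  Ring.choose α k / Complex.Gamma ((k : ℂ) - α + 1)

/-- The `k`-th term `binom(α, k) x^(k - α) / Γ(k - α + 1) * f^(k)(x)` of the series. -/
noncomputable def rlTerm (α : ℂ) (f : ℝ → ℂ) (x : ℝ) (k : ℕ) : ℂ :=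
  rlCoeff α k * (x : ℂ) ^ ((k : ℂ) - α) * iteratedDeriv k f x

/-!
For `α` not a natural number the `k`-th term is a constant times `e k = D k / (k - α)`, where `D k`
is the `k`-th Taylor coefficient at `v = 0` of `v ↦ f (x (1 - v))`; integrating that Taylor series
term by term against `v ^ (-α - 1)` therefore produces the series formally.

Hypothesis 1 bounds the Taylor coefficients of `f` at each point of `(0, x]` separately. A Baire
category argument (Pringsheim–Boas) makes these bounds uniform on each `[a, x]`, with a radius
independent of `a`, so `f` is real analytic on `(0, x]` and continues analytically across `0`.
Hence `∑ D k z ^ k`, and with it `∑ e k z ^ k`, is regular at `z = 1`. By hypothesis 2 `e k → 0`,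
so Fatou's theorem gives convergence of `∑ e k`. Its value is the Abel limit, which is computed from
the integral when `-α` has positive real part, and in general by comparing `n` integrations by parts
with the Euler operator `γ + z d/dz`, which multiplies the `k`-th coefficient by `k + γ`.
-/

section Smooth

variable {𝕜 E : Type*} [NontriviallyNormedField 𝕜] [NormedAddCommGroup E] [NormedSpace 𝕜 E]

theorem iteratedDeriv_iteratedDeriv (j k : ℕ) (f : 𝕜 → E) :
    iteratedDeriv j (iteratedDeriv k f) = iteratedDeriv (j + k) f := by
  simp only [iteratedDeriv_eq_iterate, Function.iterate_add_apply]

theorem contDiffAt_iteratedDeriv {f : 𝕜 → E} {u : 𝕜} (hf : ContDiffAt 𝕜 ∞ f u) (k : ℕ) :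
    ContDiffAt 𝕜 ∞ (iteratedDeriv k f) u := by
  induction k with
  | zero => simpa using hf
  | succ k ih =>
    rw [iteratedDeriv_succ]
    exact ih.derivWithin (by simp)

theorem hasDerivAt_iteratedDeriv {f : 𝕜 → E} {u : 𝕜} (hf : ContDiffAt 𝕜 ∞ f u) (k : ℕ) :
    HasDerivAt (iteratedDeriv k f) (iteratedDeriv (k + 1) f u) u := by
  rw [iteratedDeriv_succ]
  exact ((contDiffAt_iteratedDeriv hf k).differentiableAt (by simp)).hasDerivAt

end Smooth

section Taylor

open scoped Nat

variable {E : Type*} [NormedAddCommGroup E] [NormedSpace ℝ E] {f : ℝ → E} {s t r : ℝ}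

theorem norm_sub_taylor_sum_le [CompleteSpace E] {M : ℝ} (m : ℕ)
    (hf : ∀ u ∈ Set.uIcc t s, ContDiffAt ℝ ∞ f u)
    (hM : ∀ u ∈ Set.uIcc t s, ‖iteratedDeriv (m + 1) f u‖ ≤ M) :
    ‖f s - ∑ j ∈ Finset.range (m + 1), ((s - t) ^ j / j !) • iteratedDeriv j f t‖
      ≤ M * |s - t| ^ (m + 1) / m ! := by
  rcases eq_or_ne t s with rfl | hts
  · simp [Finset.sum_range_succ']
  have hwithin : ∀ k, ∀ u ∈ Set.uIcc t s,
      iteratedDerivWithin k f (Set.uIcc t s) u = iteratedDeriv k f u := fun k u hu =>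
    iteratedDerivWithin_eq_iteratedDeriv (uniqueDiffOn_uIcc hts)
      ((hf u hu).of_le (by exact_mod_cast le_top)) hu
  have hremainder := taylor_integral_remainder (n := m)
    (fun u hu => ((hf u hu).of_le (by exact_mod_cast le_top)).contDiffWithinAt)
  simp only [taylor_within_apply, hwithin _ t Set.left_mem_uIcc, inv_mul_eq_div] at hremainder
  rw [hremainder]
  calc _ ≤ (|s - t| ^ m / m ! * M) * |s - t| := by
        refine intervalIntegral.norm_integral_le_of_norm_le_const fun u hu => ?_
        have huIcc := Set.uIoc_subset_uIcc hu
        rw [norm_smul, norm_div, norm_pow, Real.norm_eq_abs, Real.norm_natCast, hwithin _ u huIcc]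
        gcongr ?_ ^ m / _ * ?_
        · exact Set.abs_sub_right_of_mem_uIcc huIcc
        · exact hM u huIcc
    _ = M * |s - t| ^ (m + 1) / m ! := by ring

/-- Cauchy estimates of radius `r` for all derivatives of `f`, with a constant uniform on `S`. -/
def CauchyBoundOn (f : ℝ → E) (r : ℝ) (S : Set ℝ) : Prop :=
  ∃ C : ℝ, ∀ t ∈ S, ∀ k : ℕ, ‖iteratedDeriv k f t‖ ≤ C * (k ! / r ^ k)

namespace CauchyBoundOn

theorem mono {S T : Set ℝ} (h : CauchyBoundOn f r T) (hST : S ⊆ T) : CauchyBoundOn f r S :=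
  h.imp fun _ hC t ht => hC t (hST ht)

theorem union (hr : 0 < r) {S T : Set ℝ} (hS : CauchyBoundOn f r S) (hT : CauchyBoundOn f r T) :
    CauchyBoundOn f r (S ∪ T) := by
  obtain ⟨C, hC⟩ := hS
  obtain ⟨D, hD⟩ := hT
  refine ⟨max C D, ?_⟩
  rintro t (ht | ht) k
  · exact (hC t ht k).trans (by gcongr; exact le_max_left _ _)
  · exact (hD t ht k).trans (by gcongr; exact le_max_right _ _)

theorem of_isCompact (hr : 0 < r) {S : Set ℝ} (hS : IsCompact S)
    (hloc : ∀ t ∈ S, ∃ V ∈ 𝓝[S] t, CauchyBoundOn f r V) : CauchyBoundOn f r S :=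
  hS.induction_on ⟨0, by simp⟩ (fun _ _ hst ht => ht.mono hst)
    (fun _ _ hs ht => hs.union hr ht) hloc

theorem iteratedDeriv_half {S : Set ℝ} (hr : 0 < r) (h : CauchyBoundOn f r S) (k : ℕ) :
    CauchyBoundOn (iteratedDeriv k f) (r / 2) S := by
  obtain ⟨C, hC⟩ := h
  refine ⟨C * (k ! * 2 ^ k / r ^ k), fun t ht j => ?_⟩
  have hC0 : 0 ≤ C := by simpa using (norm_nonneg _).trans (hC t ht 0)
  have hfactorial : ((j + k)! : ℝ) ≤ 2 ^ (j + k) * (j ! * k !) := by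
    rw [← Nat.add_choose_mul_factorial_mul_factorial j k, mul_assoc]
    push_cast
    gcongr
    exact_mod_cast Nat.choose_le_two_pow _ _
  rw [iteratedDeriv_iteratedDeriv]
  calc _ ≤ C * ((j + k)! / r ^ (j + k)) := hC t ht (j + k)
    _ ≤ C * (2 ^ (j + k) * (j ! * k !) / r ^ (j + k)) := by gcongr
    _ = C * (k ! * 2 ^ k / r ^ k) * (j ! / (r / 2) ^ j) := by
      rw [pow_add, pow_add, div_pow r 2 j]
      field_simp

theorem hasSum_taylor [CompleteSpace E] (hr : 0 < r)
    (h : CauchyBoundOn f r (Set.uIcc t s)) (hf : ∀ u ∈ Set.uIcc t s, ContDiffAt ℝ ∞ f u)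
    (hst : |s - t| < r) :
    HasSum (fun j : ℕ => ((s - t) ^ j / j !) • iteratedDeriv j f t) (f s) := by
  obtain ⟨C, hC⟩ := h
  set q := |s - t| / r with hq
  have hq0 : 0 ≤ q := by positivity
  have hq1 : q < 1 := (div_lt_one hr).2 hst
  have hsummable : Summable fun j : ℕ => ‖((s - t) ^ j / j !) • iteratedDeriv j f t‖ := by
    refine .of_nonneg_of_le (fun _ => norm_nonneg _) (fun j => ?_)
      ((summable_geometric_of_lt_one hq0 hq1).mul_left C)
    rw [norm_smul, norm_div, norm_pow, Real.norm_eq_abs, Real.norm_natCast]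
    calc _ ≤ |s - t| ^ j / j ! * (C * (j ! / r ^ j)) := by
          gcongr; exact hC t Set.left_mem_uIcc j
      _ = C * q ^ j := by
          rw [hq, div_pow]
          field_simp
  rw [hasSum_iff_tendsto_nat_of_summable_norm hsummable, ← tendsto_add_atTop_iff_nat 1,
    tendsto_iff_norm_sub_tendsto_zero]
  have hlim : Tendsto (fun m : ℕ => C * (((m + 1 : ℕ) : ℝ) ^ 1 * q ^ (m + 1))) atTop (𝓝 0) := by
    simpa using ((tendsto_pow_const_mul_const_pow_of_lt_one 1 hq0 hq1).comp
      (tendsto_add_atTop_nat 1)).const_mul C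
  refine squeeze_zero (fun _ => norm_nonneg _) (fun m => ?_) hlim
  rw [norm_sub_rev]
  refine (norm_sub_taylor_sum_le m hf fun u hu => hC u hu (m + 1)).trans (le_of_eq ?_)
  rw [hq, div_pow, Nat.factorial_succ]
  push_cast
  field_simp

end CauchyBoundOn

theorem norm_hasSum_le_of_cauchyBound {a : E} {g : ℕ → E} {C R q : ℝ} (hR : 0 < R) (hq0 : 0 ≤ q)
    (hq1 : q < 1) (hst : |s - t| ≤ q * R) (k : ℕ)
    (hg : ∀ j : ℕ, ‖g (j + k)‖ ≤ C * ((j + k)! / R ^ (j + k)))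
    (hsum : HasSum (fun j : ℕ => ((s - t) ^ j / j !) • g (j + k)) a) :
    ‖a‖ ≤ C * (k ! / R ^ k) * (1 / (1 - q) ^ (k + 1)) := by
  have hC0 : 0 ≤ C * (k ! / R ^ k) := by simpa using (norm_nonneg _).trans (hg 0)
  have hgeometric := (hasSum_choose_mul_geometric_of_norm_lt_one k
    (r := q) (by rwa [Real.norm_of_nonneg hq0])).mul_left (C * (k ! / R ^ k))
  rw [← hsum.tsum_eq]
  refine tsum_of_norm_bounded hgeometric fun j => ?_
  rw [norm_smul, norm_div, norm_pow, Real.norm_eq_abs, Real.norm_natCast]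
  have : 0 ≤ C := by
    have : (0 : ℝ) < k ! / R ^ k := by positivity
    exact nonneg_of_mul_nonneg_left hC0 this
  have hchoose : ((j + k).choose k : ℝ) * k ! * j ! = (j + k)! := by
    rw [← Nat.add_choose_mul_factorial_mul_factorial j k, ← Nat.choose_symm_add]
    push_cast
    ring
  calc |s - t| ^ j / j ! * ‖g (j + k)‖
      ≤ (q * R) ^ j / j ! * (C * ((j + k)! / R ^ (j + k))) := by
        gcongr
        exact hg j
    _ = C * (k ! / R ^ k) * (((j + k).choose k : ℝ) * q ^ j) := by
        rw [← hchoose, pow_add, mul_pow]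
        field_simp

theorem norm_iteratedDeriv_le_of_cauchyBound [CompleteSpace E] {C R : ℝ} (hR : 0 < R)
    (hf : ∀ u ∈ Set.uIcc t s, ContDiffAt ℝ ∞ f u)
    (h : CauchyBoundOn f (R / 2) (Set.uIcc t s)) (hst : |s - t| ≤ R / 8)
    (ht : ∀ k : ℕ, ‖iteratedDeriv k f t‖ ≤ C * (k ! / R ^ k)) (k : ℕ) :
    ‖iteratedDeriv k f s‖ ≤ 2 * C * (k ! / (R / 2) ^ k) := by
  have hC0 : 0 ≤ C := by simpa using (norm_nonneg _).trans (ht 0)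
  have hsum := (h.iteratedDeriv_half (by positivity) k).hasSum_taylor (by positivity)
    (fun u hu => contDiffAt_iteratedDeriv (hf u hu) k) (by linarith : |s - t| < R / 2 / 2)
  simp only [iteratedDeriv_iteratedDeriv] at hsum
  calc ‖iteratedDeriv k f s‖
      ≤ C * (k ! / R ^ k) * (1 / (1 - 1 / 8) ^ (k + 1)) :=
        norm_hasSum_le_of_cauchyBound (g := fun j => iteratedDeriv j f t) (q := 1 / 8) hR
          (by norm_num) (by norm_num) (by linarith) k (fun j => ht (j + k)) hsum
    _ ≤ C * (k ! / R ^ k) * 2 ^ (k + 1) := by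
        rw [← one_div_pow]
        gcongr
        norm_num
    _ = 2 * C * (k ! / (R / 2) ^ k) := by
        rw [div_pow, pow_succ]
        field_simp

end Taylor

section PringsheimBoas

open scoped Nat

theorem exists_isOpen_forall_le_of_forall_exists_le {X ι : Type*} [TopologicalSpace X]
    [BaireSpace X] [Nonempty X] {F : ι → X → ℝ} (hF : ∀ i, Continuous (F i))
    (hbdd : ∀ p, ∃ C, ∀ i, F i p ≤ C) :
    ∃ (C : ℝ) (U : Set X), IsOpen U ∧ U.Nonempty ∧ ∀ p ∈ U, ∀ i, F i p ≤ C := by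
  obtain ⟨n, hn⟩ := nonempty_interior_of_iUnion_of_closed
    (f := fun n : ℕ => ⋂ i, {p | F i p ≤ n})
    (fun n => isClosed_iInter fun i => isClosed_le (hF i) continuous_const)
    (Set.eq_univ_of_forall fun p => by
      obtain ⟨C, hC⟩ := hbdd p
      obtain ⟨n, hCn⟩ := exists_nat_ge C
      exact Set.mem_iUnion.2 ⟨n, Set.mem_iInter.2 fun i => (hC i).trans hCn⟩)
  refine ⟨n, _, isOpen_interior, hn, fun p hp i => ?_⟩
  simpa using Set.mem_iInter.1 (interior_subset hp) i

theorem exists_nearest_mem_uIcc {S : Set ℝ} (hS : IsClosed S) {z : ℝ} (hz : z ∈ S) (t : ℝ) :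
    ∃ c ∈ S, c ∈ Set.uIcc z t ∧ ∀ p ∈ Set.uIcc c t, p ∈ S → p = c := by
  obtain ⟨c, ⟨hcS, hcz⟩, hmin⟩ := (isCompact_uIcc (a := z) (b := t)).inter_left hS
    |>.exists_isMinOn (f := fun u => |u - t|) ⟨z, hz, Set.left_mem_uIcc⟩ (by fun_prop)
  refine ⟨c, hcS, hcz, fun p hp hpS => ?_⟩
  have hle : |c - t| ≤ |p - t| :=
    hmin ⟨hpS, Set.uIcc_subset_uIcc hcz Set.right_mem_uIcc hp⟩
  rcases Set.mem_uIcc.1 hp with ⟨h1, h2⟩ | ⟨h1, h2⟩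
  · rw [abs_of_nonpos (by linarith), abs_of_nonpos (by linarith)] at hle
    linarith
  · rw [abs_of_nonneg (by linarith), abs_of_nonneg (by linarith)] at hle
    linarith

variable {E : Type*} [NormedAddCommGroup E] [NormedSpace ℝ E] {f : ℝ → E} {R : ℝ}

theorem exists_ball_forall_norm_iteratedDeriv_le {S : Set ℝ} (hS : IsClosed S)
    (hne : S.Nonempty) (hR : 0 < R) (hf : ∀ u ∈ S, ContDiffAt ℝ ∞ f u)
    (hpt : ∀ t ∈ S, ∃ C : ℝ, ∀ k : ℕ, ‖iteratedDeriv k f t‖ ≤ C * (k ! / R ^ k)) :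
    ∃ z ∈ S, ∃ ε > 0, ∃ C : ℝ, ∀ t ∈ S, |t - z| < ε →
      ∀ k : ℕ, ‖iteratedDeriv k f t‖ ≤ C * (k ! / R ^ k) := by
  have : Nonempty S := hne.to_subtype
  have : CompleteSpace S := hS.completeSpace_coe
  have hcont (k : ℕ) : ContinuousOn (iteratedDeriv k f) S := fun t ht =>
    (hasDerivAt_iteratedDeriv (hf t ht) k).continuousAt.continuousWithinAt
  obtain ⟨C, U, hU, ⟨z, hz⟩, hC⟩ := exists_isOpen_forall_le_of_forall_exists_le
    (F := fun (k : ℕ) (t : S) => ‖iteratedDeriv k f t‖ / (k ! / R ^ k))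
    (fun k => (hcont k).domRestrict.norm.div_const _)
    (fun t => (hpt t t.2).imp fun C hC k => (div_le_iff₀ (by positivity)).2 (hC k))
  obtain ⟨ε, hε, hball⟩ := Metric.isOpen_iff.1 hU z hz
  exact ⟨z, z.2, ε, hε, C, fun t ht htz k =>
    (div_le_iff₀ (by positivity)).1 (hC ⟨t, ht⟩ (hball htz) k)⟩

variable [CompleteSpace E]

-- Uniformity up to the exceptional endpoint `c` takes two transfers: first from `t` towards `c`,
-- which yields some constant on all of `[t, c]`, then from `c` to `t`, which yields the right one.
theorem norm_iteratedDeriv_le_of_cauchyBound_off_endpoint {c t C : ℝ} (hR : 0 < R)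
    (hf : ∀ u ∈ Set.uIcc c t, ContDiffAt ℝ ∞ f u) (hct : |t - c| ≤ R / 8)
    (hloc : ∀ p ∈ Set.uIcc c t, p ≠ c → ∃ V ∈ 𝓝[Set.uIcc c t] p, CauchyBoundOn f (R / 2) V)
    (hc : ∀ k : ℕ, ‖iteratedDeriv k f c‖ ≤ C * (k ! / R ^ k))
    (ht : ∃ D : ℝ, ∀ k : ℕ, ‖iteratedDeriv k f t‖ ≤ D * (k ! / R ^ k)) (k : ℕ) :
    ‖iteratedDeriv k f t‖ ≤ 2 * C * (k ! / (R / 2) ^ k) := by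
  have hR2 : 0 < R / 2 := by positivity
  obtain ⟨D, hD⟩ := ht
  have hendpoint : CauchyBoundOn f (R / 2) {c} := by
    refine ⟨C, ?_⟩
    rintro _ rfl j
    have hC0 : 0 ≤ C := by simpa using (norm_nonneg _).trans (hc 0)
    refine (hc j).trans ?_
    gcongr
    linarith
  have hrest : CauchyBoundOn f (R / 2) (Set.uIcc c t \ {c}) := by
    refine ⟨2 * D, fun p ⟨hp, hpc⟩ => ?_⟩
    have hsub : Set.uIcc t p ⊆ Set.uIcc c t := Set.uIcc_subset_uIcc Set.right_mem_uIcc hp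
    refine norm_iteratedDeriv_le_of_cauchyBound hR (fun u hu => hf u (hsub hu)) ?_
      (by rw [abs_sub_comm]; exact (Set.abs_sub_right_of_mem_uIcc hp).trans hct) hD
    refine .of_isCompact hR2 isCompact_uIcc fun u hu => ?_
    obtain ⟨V, hV, hVbound⟩ := hloc u (hsub hu) (by
      rintro rfl
      rcases Set.mem_uIcc.1 hp with h | h <;> rcases Set.mem_uIcc.1 hu with h' | h' <;>
        exact hpc (le_antisymm (by linarith) (by linarith)))
    exact ⟨V, nhdsWithin_mono u hsub hV, hVbound⟩
  refine norm_iteratedDeriv_le_of_cauchyBound hR hf ?_ hct hc k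
  exact (hendpoint.union hR2 hrest).mono fun u hu => by
    by_cases h : u = c <;> simp_all

theorem cauchyBoundOn_of_forall_exists {K : Set ℝ} (hK : IsCompact K) (hKord : K.OrdConnected)
    (hR : 0 < R) (hf : ∀ u ∈ K, ContDiffAt ℝ ∞ f u)
    (hpt : ∀ t ∈ K, ∃ C : ℝ, ∀ k : ℕ, ‖iteratedDeriv k f t‖ ≤ C * (k ! / R ^ k)) :
    CauchyBoundOn f (R / 2) K := by
  set good : Set ℝ := ⋃₀ {V | IsOpen V ∧ CauchyBoundOn f (R / 2) (K ∩ V)}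
  have hgood_local : ∀ p ∈ good, ∃ V ∈ 𝓝[K] p, CauchyBoundOn f (R / 2) V := by
    rintro p ⟨V, ⟨hV, hVbound⟩, hpV⟩
    exact ⟨K ∩ V, inter_mem self_mem_nhdsWithin (mem_nhdsWithin_of_mem_nhds (hV.mem_nhds hpV)),
      hVbound⟩
  have hbad_closed : IsClosed (K \ good) :=
    hK.isClosed.sdiff (isOpen_sUnion fun V hV => hV.1)
  suffices hbad : K \ good = ∅ from
    .of_isCompact (by positivity) hK fun t ht => hgood_local t (Set.sdiff_eq_empty.1 hbad ht)
  by_contra! hne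
  obtain ⟨z, ⟨hzK, hz⟩, ε, hε, C, hC⟩ := exists_ball_forall_norm_iteratedDeriv_le hbad_closed hne hR
    (fun u hu => hf u hu.1) (fun t ht => hpt t ht.1)
  refine hz ⟨Metric.ball z (min ε (R / 8)), ⟨Metric.isOpen_ball, 2 * C, ?_⟩,
    Metric.mem_ball_self (by positivity)⟩
  rintro t ⟨htK, htz⟩
  rw [Metric.mem_ball, Real.dist_eq, lt_min_iff] at htz
  obtain ⟨c, hc, hcz, hnearest⟩ := exists_nearest_mem_uIcc hbad_closed ⟨hzK, hz⟩ t
  have hsub : Set.uIcc c t ⊆ K := hKord.uIcc_subset hc.1 htK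
  refine norm_iteratedDeriv_le_of_cauchyBound_off_endpoint hR (fun u hu => hf u (hsub hu))
    ((Set.abs_sub_right_of_mem_uIcc hcz).trans htz.2.le) (fun p hp hpc => ?_)
    (hC c hc ((Set.abs_sub_left_of_mem_uIcc hcz).trans_lt htz.1)) (hpt t htK)
  obtain ⟨V, hV, hVbound⟩ := hgood_local p (by
    by_contra hpbad
    exact hpc (hnearest p hp ⟨hsub hp, hpbad⟩))
  exact ⟨V, nhdsWithin_mono p hsub hV, hVbound⟩

end PringsheimBoas

section PowerSeries

/-- Absolute convergence of the power series `∑ D k * z ^ k` on the disc `‖z‖ < R`. -/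
def SummableOnDisc (D : ℕ → ℂ) (R : ℝ) : Prop :=
  ∀ q : ℝ, 0 ≤ q → q < R → Summable fun k => ‖D k‖ * q ^ k

theorem tendsto_inv_natCast_add (γ : ℂ) : Tendsto (fun k : ℕ => ((k : ℂ) + γ)⁻¹) atTop (𝓝 0) := by
  refine tendsto_inv₀_cobounded.comp (tendsto_norm_atTop_iff_cobounded.1 ?_)
  refine tendsto_atTop_mono (f := fun k : ℕ => (k : ℝ) - ‖γ‖) (fun k => ?_)
    (tendsto_atTop_add_const_right _ _ tendsto_natCast_atTop_atTop)
  simpa using norm_sub_norm_le (k : ℂ) (-γ)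

namespace SummableOnDisc

variable {D E : ℕ → ℂ} {R : ℝ} {z : ℂ}

theorem summable_norm (hD : SummableOnDisc D R) (hz : ‖z‖ < R) :
    Summable fun k => ‖D k * z ^ k‖ := by
  simpa only [norm_mul, norm_pow] using hD ‖z‖ (norm_nonneg z) hz

theorem hasSum (hD : SummableOnDisc D R) (hz : ‖z‖ < R) :
    HasSum (fun k => D k * z ^ k) (∑' k, D k * z ^ k) :=
  (hD.summable_norm hz).of_norm.hasSum

theorem of_norm_le_mul (hD : SummableOnDisc D R) {C : ℝ} (h : ∀ k, ‖E k‖ ≤ C * ‖D k‖) :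
    SummableOnDisc E R := by
  intro q hq0 hq1
  refine .of_nonneg_of_le (fun k => by positivity) (fun k => ?_) ((hD q hq0 hq1).mul_left C)
  rw [← mul_assoc]
  gcongr
  exact h k

theorem of_norm_le_geometric {C : ℝ} (h : ∀ k : ℕ, ‖D k‖ ≤ C * (R⁻¹) ^ k) :
    SummableOnDisc D R := by
  intro q hq0 hqR
  have hq1 : R⁻¹ * q < 1 := by
    rw [inv_mul_eq_div]
    exact (div_lt_one (hq0.trans_lt hqR)).2 hqR
  refine .of_nonneg_of_le (fun k => by positivity) (fun k => ?_)
    ((summable_geometric_of_lt_one (mul_nonneg (inv_nonneg.2 (hq0.trans hqR.le)) hq0)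
      hq1).mul_left C)
  rw [mul_pow, ← mul_assoc]
  gcongr
  exact h k

theorem of_norm_le_linear {C : ℝ} (h : ∀ k : ℕ, ‖D k‖ ≤ C * (k + 1)) : SummableOnDisc D 1 := by
  intro q hq0 hq1
  refine .of_nonneg_of_le (fun k => by positivity) (fun k => ?_)
    (((summable_pow_mul_geometric_of_norm_lt_one 1 (r := q)
      (by rwa [Real.norm_of_nonneg hq0])).add (summable_geometric_of_lt_one hq0 hq1)).mul_left C)
  calc ‖D k‖ * q ^ k ≤ C * (k + 1) * q ^ k := by gcongr; exact h k
    _ = C * ((k : ℝ) ^ 1 * q ^ k + q ^ k) := by ring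

theorem div_natCast_add (hD : SummableOnDisc D R) (γ : ℂ) :
    SummableOnDisc (fun k => D k / (k + γ)) R := by
  obtain ⟨C, hC⟩ := (tendsto_inv_natCast_add γ).norm.bddAbove_range
  refine hD.of_norm_le_mul (C := C) fun k => ?_
  rw [div_eq_mul_inv, norm_mul, mul_comm]
  gcongr
  exact hC ⟨k, rfl⟩

theorem norm_le_of_mem_ball {q : ℝ} {w : ℂ} (hw : w ∈ Metric.ball (0 : ℂ) q) (k : ℕ) :
    ‖D k * w ^ k‖ ≤ ‖D k‖ * q ^ k := by
  rw [norm_mul, norm_pow]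
  gcongr
  exact (mem_ball_zero_iff.1 hw).le

theorem differentiableOn (hD : SummableOnDisc D R) :
    DifferentiableOn ℂ (fun z => ∑' k, D k * z ^ k) (Metric.ball 0 R) := by
  intro z hz
  rw [mem_ball_zero_iff] at hz
  obtain ⟨q, hzq, hq1⟩ := exists_between hz
  have h := Complex.differentiableOn_tsum_of_summable_norm
    (F := fun k (z : ℂ) => D k * z ^ k) (U := Metric.ball 0 q)
    (hD q ((norm_nonneg z).trans hzq.le) hq1) (fun k => by fun_prop) Metric.isOpen_ball
    (fun k w hw => norm_le_of_mem_ball hw k)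
  exact (h.differentiableAt (Metric.isOpen_ball.mem_nhds
    (mem_ball_zero_iff.2 hzq))).differentiableWithinAt

theorem hasDerivAt (hD : SummableOnDisc D R) (hz : ‖z‖ < R) :
    HasDerivAt (fun z => ∑' k, D k * z ^ k) (deriv (fun z => ∑' k, D k * z ^ k) z) z :=
  (hD.differentiableOn.differentiableAt
    (Metric.isOpen_ball.mem_nhds (mem_ball_zero_iff.2 hz))).hasDerivAt

theorem hasSum_deriv (hD : SummableOnDisc D R) (hz : ‖z‖ < R) :
    HasSum (fun k : ℕ => ((k : ℂ) + 1) * D (k + 1) * z ^ k)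
      (deriv (fun z => ∑' k, D k * z ^ k) z) := by
  obtain ⟨q, hzq, hq1⟩ := exists_between hz
  have h := Complex.hasSum_deriv_of_summable_norm
    (F := fun k (z : ℂ) => D k * z ^ k) (U := Metric.ball 0 q)
    (hD q ((norm_nonneg z).trans hzq.le) hq1) (fun k => by fun_prop) Metric.isOpen_ball
    (fun k w hw => norm_le_of_mem_ball hw k) (mem_ball_zero_iff.2 hzq)
  rw [← hasSum_nat_add_iff' 1] at h
  simp only [Finset.sum_range_one, pow_zero, mul_one, deriv_const, sub_zero] at h
  refine h.congr_fun fun k => ?_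
  rw [deriv_const_mul_field, deriv_pow_field]
  push_cast
  ring

theorem succ_mul_shift (hD : SummableOnDisc D R) :
    SummableOnDisc (fun k => ((k : ℂ) + 1) * D (k + 1)) R := by
  intro q hq0 hq1
  have h := (hD.hasSum_deriv (z := (q : ℂ)) (by simpa [abs_of_nonneg hq0])).summable.norm
  simpa [abs_of_nonneg hq0] using h

theorem mul_tsum_div_add_mul_deriv (hD : SummableOnDisc D R) {γ : ℂ}
    (hγ : ∀ k : ℕ, (k : ℂ) + γ ≠ 0) (hz : ‖z‖ < R) :
    γ * (∑' k, D k / (k + γ) * z ^ k) + z * deriv (fun z => ∑' k, D k / (k + γ) * z ^ k) z =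
      ∑' k, D k * z ^ k := by
  have hdiv := hD.div_natCast_add γ
  have hderiv : HasSum (fun k : ℕ => k * (D k / (k + γ)) * z ^ k)
      (z * deriv (fun z => ∑' k, D k / (k + γ) * z ^ k) z) := by
    rw [← hasSum_nat_add_iff' 1]
    simpa [pow_succ', mul_left_comm, mul_assoc] using (hdiv.hasSum_deriv hz).mul_left z
  rw [← (((hdiv.hasSum hz).mul_left γ).add hderiv).tsum_eq]
  refine tsum_congr fun k => ?_
  have := hγ k
  field_simp
  ring

theorem mul_tsum_div_eq_sub (hD : SummableOnDisc D R) {γ : ℂ}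
    (hγ : ∀ k : ℕ, (k : ℂ) + γ ≠ 0) (hz : ‖z‖ < R) :
    γ * (∑' k, D k / (k + γ) * z ^ k) = ∑' k, D k * z ^ k -
      z * ∑' k : ℕ, ((k : ℂ) + 1) * D (k + 1) / (k + (γ + 1)) * z ^ k := by
  rw [eq_sub_iff_add_eq, ← hD.mul_tsum_div_add_mul_deriv hγ hz,
    ← ((hD.div_natCast_add γ).hasSum_deriv hz).tsum_eq]
  push_cast
  simp only [mul_div_assoc, add_right_comm _ (1 : ℂ) γ, add_assoc]

theorem hasDerivAt_cpow_mul_tsum_div (hD : SummableOnDisc D R) {γ : ℂ}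
    (hγ : ∀ k : ℕ, (k : ℂ) + γ ≠ 0) (hz : ‖z‖ < R) (hslit : z ∈ Complex.slitPlane) :
    HasDerivAt (fun z => z ^ γ * ∑' k, D k / (k + γ) * z ^ k)
      (z ^ (γ - 1) * ∑' k, D k * z ^ k) z := by
  refine (((hasDerivAt_id z).cpow_const hslit).mul
    ((hD.div_natCast_add γ).hasDerivAt hz)).congr_deriv ?_
  have hz0 := Complex.slitPlane_ne_zero hslit
  rw [← hD.mul_tsum_div_add_mul_deriv hγ hz, id_eq, mul_one]
  have hpow : z ^ γ = z ^ (γ - 1) * z := by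
    rw [Complex.cpow_sub _ _ hz0, Complex.cpow_one, div_mul_cancel₀ _ hz0]
  rw [hpow]
  ring

end SummableOnDisc

end PowerSeries

section Fatou

open scoped FourierTransform SchwartzMap

section SlowVariation

variable {E : Type*} [SeminormedAddCommGroup E]

theorem norm_sub_le_mul_abs_of_norm_succ_sub_le {a : ℤ → E} {M : ℝ}
    (ha : ∀ m, ‖a (m + 1) - a m‖ ≤ M) (m j : ℤ) :
    ‖a m - a (m - j)‖ ≤ M * |(j : ℝ)| := by
  induction j using Int.induction_on with
  | zero => simp
  | succ j ih =>
    have hstep := ha (m - (j + 1))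
    rw [show m - ((j : ℤ) + 1) + 1 = m - j by ring] at hstep
    refine (norm_sub_le_norm_sub_add_norm_sub _ (a (m - j)) _).trans
      ((add_le_add ih hstep).trans_eq ?_)
    push_cast
    rw [abs_of_nonneg (by positivity), abs_of_nonneg (by positivity)]
    ring
  | pred j ih =>
    have hstep := ha (m - -j)
    rw [show m - -(j : ℤ) + 1 = m - (-j - 1) by ring, norm_sub_rev] at hstep
    refine (norm_sub_le_norm_sub_add_norm_sub _ (a (m - -j)) _).trans
      ((add_le_add ih hstep).trans_eq ?_)
    push_cast
    rw [← neg_add', abs_neg, abs_neg, abs_of_nonneg (by positivity), abs_of_nonneg (by positivity)]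
    ring

theorem tendsto_sub_shift_of_tendsto_succ_sub {a : ℤ → E}
    (ha : Tendsto (fun m => a (m + 1) - a m) atTop (𝓝 0)) (j : ℤ) :
    Tendsto (fun m => a m - a (m - j)) atTop (𝓝 0) := by
  have hshift (c : ℤ) : Tendsto (fun m : ℤ => m - c) atTop atTop :=
    tendsto_atTop_add_const_right _ (-c) tendsto_id
  induction j using Int.induction_on with
  | zero => simpa using tendsto_const_nhds
  | succ j ih =>
    have h := ih.add (ha.comp (hshift (j + 1)))
    rw [add_zero] at h
    refine h.congr fun m => ?_
    simp only [Function.comp_apply]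
    rw [show m - ((j : ℤ) + 1) + 1 = m - j by ring, sub_add_sub_cancel]
  | pred j ih =>
    have h := ih.sub (ha.comp (hshift (-j)))
    rw [sub_zero] at h
    refine h.congr fun m => ?_
    simp only [Function.comp_apply]
    rw [show m - -(j : ℤ) + 1 = m - (-j - 1) by ring, sub_sub_sub_cancel_right]

end SlowVariation

section Convolution

variable {a Λ : ℤ → ℂ} {M : ℝ}

theorem summable_mul_of_norm_succ_sub_le (ha : ∀ m, ‖a (m + 1) - a m‖ ≤ M)
    (hΛ : Summable fun j : ℤ => (1 + |(j : ℝ)|) * ‖Λ j‖) (N : ℤ) :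
    Summable fun j => a (N - j) * Λ j := by
  have hM : 0 ≤ M := (norm_nonneg _).trans (ha 0)
  refine .of_norm_bounded (hΛ.mul_left (‖a N‖ + M)) fun j => ?_
  have hgrowth : ‖a (N - j)‖ ≤ ‖a N‖ + M * |(j : ℝ)| :=
    (norm_le_norm_add_norm_sub _ _).trans
      (by gcongr; exact norm_sub_le_mul_abs_of_norm_succ_sub_le ha N j)
  rw [norm_mul, ← mul_assoc]
  gcongr
  nlinarith [mul_nonneg (norm_nonneg (a N)) (abs_nonneg (j : ℝ))]

theorem tendsto_sub_tsum_mul_of_tendsto_succ_sub (ha : ∀ m, ‖a (m + 1) - a m‖ ≤ M)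
    (ha0 : Tendsto (fun m => a (m + 1) - a m) atTop (𝓝 0))
    (hΛ : Summable fun j : ℤ => (1 + |(j : ℝ)|) * ‖Λ j‖) (hΛ1 : ∑' j, Λ j = 1) :
    Tendsto (fun N => a N - ∑' j, a (N - j) * Λ j) atTop (𝓝 0) := by
  have hM : 0 ≤ M := (norm_nonneg _).trans (ha 0)
  have hΛsum : Summable Λ := .of_norm_bounded hΛ fun j =>
    le_mul_of_one_le_left (norm_nonneg _) (le_add_of_nonneg_right (abs_nonneg _))
  have hdiff : Tendsto (fun N => ∑' j, (a N - a (N - j)) * Λ j) atTop (𝓝 (∑' _ : ℤ, 0)) := by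
    refine tendsto_tsum_of_dominated_convergence (hΛ.mul_left M) (fun j => ?_)
      (.of_forall fun N j => ?_)
    · simpa using (tendsto_sub_shift_of_tendsto_succ_sub ha0 j).mul_const (Λ j)
    · rw [norm_mul, ← mul_assoc]
      gcongr
      refine (norm_sub_le_mul_abs_of_norm_succ_sub_le ha N j).trans ?_
      gcongr
      linarith
  rw [tsum_zero] at hdiff
  refine hdiff.congr fun N => ?_
  simp only [sub_mul]
  rw [(hΛsum.mul_left (a N)).tsum_sub (summable_mul_of_norm_succ_sub_le ha hΛ N), tsum_mul_left,
    hΛ1, mul_one]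

end Convolution

section Localizer

theorem summable_int_one_add_abs_zpow_neg_two : Summable fun j : ℤ => ((1 + |(j : ℝ)|) ^ 2)⁻¹ := by
  have h : Summable fun n : ℕ => ((1 + (n : ℝ)) ^ 2)⁻¹ := by
    have := (summable_nat_add_iff 1).2 (Real.summable_nat_pow_inv.2 one_lt_two)
    simpa [add_comm] using this
  exact .of_nat_of_neg (by simpa using h) (by simpa using h)

theorem summable_one_add_abs_mul_norm_schwartz (Φ : 𝓢(ℝ, ℂ)) :
    Summable fun j : ℤ => (1 + |(j : ℝ)|) * ‖Φ j‖ := by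
  refine .of_nonneg_of_le (fun j => by positivity) (fun j => ?_)
    (summable_int_one_add_abs_zpow_neg_two.mul_left
      (2 ^ 3 * (Finset.Iic (3, 0)).sup (fun m => SchwartzMap.seminorm ℂ m.1 m.2) Φ))
  have h := SchwartzMap.one_add_le_sup_seminorm_apply (𝕜 := ℂ) (m := (3, 0)) le_rfl le_rfl Φ j
  rw [norm_iteratedFDeriv_zero, Real.norm_eq_abs] at h
  rw [← div_eq_mul_inv, le_div_iff₀ (by positivity)]
  calc (1 + |(j : ℝ)|) * ‖Φ j‖ * (1 + |(j : ℝ)|) ^ 2 = (1 + |(j : ℝ)|) ^ 3 * ‖Φ j‖ := by ring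
    _ ≤ _ := h

-- Poisson summation turns `Φ 0 = 1`, `Φ n = 0` for `n ≠ 0`, into `∑ 𝓕 Φ j = 1`.
theorem exists_schwartz_tsum_fourier_eq_one {δ : ℝ} (hδ : 0 < δ) (hδ1 : δ ≤ 1) :
    ∃ Φ : 𝓢(ℝ, ℂ), (∀ s, δ ≤ |s| → Φ s = 0) ∧ ∑' j : ℤ, 𝓕 (Φ : ℝ → ℂ) j = 1 := by
  let φ : ContDiffBump (0 : ℝ) := ⟨δ / 2, δ, half_pos hδ, half_lt_self hδ⟩
  have hsmooth : ContDiff ℝ ∞ fun s => (φ s : ℂ) := Complex.ofRealCLM.contDiff.comp φ.contDiff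
  have hcs : HasCompactSupport fun s => (φ s : ℂ) :=
    φ.hasCompactSupport.comp_left (g := fun s : ℝ => (s : ℂ)) Complex.ofReal_zero
  let Φ : 𝓢(ℝ, ℂ) := hcs.toSchwartzMap hsmooth
  have hzero (s : ℝ) (hs : δ ≤ |s|) : Φ s = 0 :=
    Complex.ofReal_eq_zero.2 (φ.zero_of_le_dist (by simpa [Real.dist_eq] using hs))
  have hone : Φ 0 = 1 :=
    Complex.ofReal_eq_one.2 (φ.one_of_mem_closedBall (Metric.mem_closedBall_self φ.rIn_pos.le))
  refine ⟨Φ, hzero, ?_⟩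
  have hpoisson := SchwartzMap.tsum_eq_tsum_fourier Φ 0
  rw [tsum_eq_single 0 fun n hn => hzero _ ?_] at hpoisson
  · simpa [hone, SchwartzMap.fourier_coe] using hpoisson.symm
  · rw [zero_add]
    exact hδ1.trans (mod_cast Int.one_le_abs hn)

end Localizer

section BoundaryBehaviour

variable {S : ℕ → ℂ}

theorem integral_fourierChar_smul_mul_pow (L : ℝ → ℂ) (N : ℤ) (k : ℕ) :
    ∫ s : ℝ, 𝐞 (-(s * N)) • (L s * (𝐞 s : ℂ) ^ k) = 𝓕 L ((N - k : ℤ) : ℝ) := by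
  rw [Real.fourier_real_eq]
  congr 1 with s
  have hexp : -(s * ((N - k : ℤ) : ℝ)) = -(s * N) + k • s := by
    push_cast
    rw [nsmul_eq_mul]
    ring
  rw [hexp, AddChar.map_add_eq_mul, AddChar.map_nsmul_eq_pow, Circle.smul_def, Circle.smul_def,
    Circle.coe_mul, Circle.coe_pow, smul_eq_mul, smul_eq_mul]
  ring

theorem hasSum_mul_fourier (hS : SummableOnDisc S 1) {L : ℝ → ℂ} (hL : MeasureTheory.Integrable L)
    (N : ℤ) {z : ℂ} (hz : ‖z‖ < 1) :
    HasSum (fun k : ℕ => S k * z ^ k * 𝓕 L ((N - k : ℤ) : ℝ))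
      (∫ s : ℝ, 𝐞 (-(s * N)) • (L s * ∑' k, S k * (z * 𝐞 s) ^ k)) := by
  have hnorm (k : ℕ) (s : ℝ) :
      ‖𝐞 (-(s * N)) • (L s * (S k * (z * 𝐞 s) ^ k))‖ = ‖L s‖ * ‖S k * z ^ k‖ := by
    rw [Circle.norm_smul, norm_mul, norm_mul, norm_pow, norm_mul, Circle.norm_coe, mul_one,
      norm_mul, norm_pow]
  have hint (k : ℕ) :
      MeasureTheory.Integrable fun s : ℝ => 𝐞 (-(s * N)) • (L s * (S k * (z * 𝐞 s) ^ k)) := by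
    refine (hL.norm.mul_const ‖S k * z ^ k‖).mono' ?_ (.of_forall fun s => (hnorm k s).le)
    have hmeas := hL.aestronglyMeasurable
    have hchar : Continuous fun s : ℝ => 𝐞 (-(s * N)) := by fun_prop
    have hpow : Continuous fun s : ℝ => S k * (z * 𝐞 s) ^ k := by fun_prop
    exact hchar.aestronglyMeasurable.smul (hmeas.mul hpow.aestronglyMeasurable)
  have key := MeasureTheory.hasSum_integral_of_summable_integral_norm hint (by
    simp only [hnorm, MeasureTheory.integral_mul_const]
    exact (hS.summable_norm hz).mul_left _)
  simp only [Circle.smul_def, tsum_const_smul'', tsum_mul_left] at key ⊢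
  refine key.congr_fun fun k => ?_
  rw [← integral_fourierChar_smul_mul_pow, ← MeasureTheory.integral_const_mul]
  congr 1 with s
  rw [Circle.smul_def, smul_eq_mul, smul_eq_mul]
  ring

theorem tsum_mul_fourier_eq_integral (hS : SummableOnDisc S 1) {L : ℝ → ℂ} (hL : Continuous L)
    {δ : ℝ} (hLδ : ∀ s, δ ≤ |s| → L s = 0) {H : ℂ → ℂ} (hH : Continuous H)
    (hSH : ∀ᶠ r : ℝ in 𝓝[<] 1, ∀ s : ℝ, |s| < δ →
      ∑' k, S k * ((r : ℂ) * 𝐞 s) ^ k = H ((r : ℂ) * 𝐞 s))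
    (N : ℤ) (hN : Summable fun k : ℕ => S k * 𝓕 L ((N - k : ℤ) : ℝ)) :
    ∑' k : ℕ, S k * 𝓕 L ((N - k : ℤ) : ℝ) = ∫ s : ℝ, 𝐞 (-(s * N)) • (L s * H (𝐞 s)) := by
  have hzero (s : ℝ) (hs : s ∉ Set.Icc (-δ) δ) : L s = 0 :=
    hLδ s (not_lt.1 fun h => hs (abs_le.1 h.le))
  have hLint : MeasureTheory.Integrable L :=
    hL.integrable_of_hasCompactSupport (.intro isCompact_Icc hzero)
  have hcont : Continuous fun r : ℝ =>
      ∫ s : ℝ, 𝐞 (-(s * N)) • (L s * H ((r : ℂ) * 𝐞 s)) := by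
    refine continuousOn_univ.1 (continuousOn_integral_of_compact_support
      (isCompact_Icc (a := -δ) (b := δ)) ?_ fun r s _ hs => by simp [hzero s hs])
    fun_prop
  have habel : Tendsto (fun r : ℝ => ∑' k : ℕ, S k * 𝓕 L ((N - k : ℤ) : ℝ) * (r : ℂ) ^ k)
      (𝓝[<] 1) (𝓝 (∑' k : ℕ, S k * 𝓕 L ((N - k : ℤ) : ℝ))) :=
    tendsto_map'_iff.1
      (Complex.tendsto_tsum_powerSeries_nhdsWithin_lt hN.hasSum.tendsto_sum_nat)
  refine tendsto_nhds_unique habel (Tendsto.congr' ?_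
    (by simpa using (hcont.tendsto 1).mono_left (nhdsWithin_le_nhds (s := Set.Iio 1))))
  filter_upwards [hSH, self_mem_nhdsWithin,
    mem_nhdsWithin_of_mem_nhds (lt_mem_nhds one_pos)] with r hr hr1 hr0
  have hr' : ‖(r : ℂ)‖ < 1 := by rwa [Complex.norm_real, Real.norm_of_nonneg (le_of_lt hr0)]
  have hdisc := (hasSum_mul_fourier hS hLint N hr').tsum_eq
  simp only [mul_right_comm] at hdisc ⊢
  rw [hdisc]
  congr 1 with s
  rcases lt_or_ge |s| δ with hs | hs
  · rw [hr s hs]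
  · simp [hLδ s hs]

/-- The bi-infinite sequence equal to `S k` at `k : ℕ` and to `0` at the negative integers, so that
convolutions of `S` can be written as sums over `ℤ`. -/
noncomputable def extendByZero (S : ℕ → ℂ) : ℤ → ℂ := Function.extend (↑) S 0

theorem extendByZero_natCast (S : ℕ → ℂ) (k : ℕ) : extendByZero S k = S k :=
  Nat.cast_injective.extend_apply S 0 k

theorem extendByZero_of_neg (S : ℕ → ℂ) {m : ℤ} (hm : m < 0) : extendByZero S m = 0 :=
  Function.extend_apply' _ _ _ (by omega)

theorem norm_extendByZero_succ_sub_le {M : ℝ} (h0 : ‖S 0‖ ≤ M)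
    (hS : ∀ k, ‖S (k + 1) - S k‖ ≤ M) (m : ℤ) :
    ‖extendByZero S (m + 1) - extendByZero S m‖ ≤ M := by
  rcases lt_trichotomy m (-1) with hm | rfl | hm
  · rw [extendByZero_of_neg S (by omega), extendByZero_of_neg S (by omega), sub_zero, norm_zero]
    exact (norm_nonneg _).trans h0
  · rw [extendByZero_of_neg S (m := -1) (by omega), sub_zero, neg_add_cancel]
    simpa using (congrArg norm (extendByZero_natCast S 0)).trans_le h0
  · obtain ⟨k, rfl⟩ := Int.eq_ofNat_of_zero_le (show 0 ≤ m by omega)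
    rw [extendByZero_natCast, ← Nat.cast_succ, extendByZero_natCast]
    exact hS k

theorem tendsto_extendByZero_succ_sub (hS : Tendsto (fun k => S (k + 1) - S k) atTop (𝓝 0)) :
    Tendsto (fun m => extendByZero S (m + 1) - extendByZero S m) atTop (𝓝 0) := by
  rw [← Nat.map_cast_int_atTop, tendsto_map'_iff]
  refine hS.congr fun k => ?_
  rw [Function.comp_apply, ← Nat.cast_succ, extendByZero_natCast, extendByZero_natCast]

theorem tsum_mul_sub_natCast_eq_tsum_extendByZero (S : ℕ → ℂ) (Λ : ℤ → ℂ) (N : ℤ) :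
    ∑' k : ℕ, S k * Λ (N - k) = ∑' j, extendByZero S (N - j) * Λ j := by
  rw [← (Equiv.subLeft N).tsum_eq]
  simp only [Equiv.subLeft_apply, sub_sub_cancel]
  rw [← (Nat.cast_injective (R := ℤ)).tsum_eq]
  · simp only [extendByZero_natCast]
  · exact fun m hm => ⟨m.toNat, Int.toNat_of_nonneg
      (not_lt.1 fun h => hm (by simp [extendByZero_of_neg S h]))⟩

theorem SummableOnDisc.of_norm_succ_sub_le {M : ℝ} (h0 : ‖S 0‖ ≤ M)
    (hS : ∀ k, ‖S (k + 1) - S k‖ ≤ M) : SummableOnDisc S 1 := by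
  refine .of_norm_le_linear (C := M) fun k => ?_
  have h := norm_sub_le_mul_abs_of_norm_succ_sub_le (norm_extendByZero_succ_sub_le h0 hS) k (k + 1)
  rw [extendByZero_natCast, extendByZero_of_neg S (by omega), sub_zero] at h
  exact h.trans_eq (by rw [abs_of_nonneg (by positivity)]; push_cast; rfl)

theorem exists_forall_abs_lt_of_eventually_nhds_one {p : ℂ → Prop}
    (hp : ∀ᶠ z in 𝓝 (1 : ℂ), ‖z‖ < 1 → p z) :
    ∃ δ > 0, δ ≤ 1 ∧ ∀ᶠ r : ℝ in 𝓝[<] 1, ∀ s : ℝ, |s| < δ → p ((r : ℂ) * 𝐞 s) := by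
  have hlim : Tendsto (fun q : ℝ × ℝ => (q.1 : ℂ) * 𝐞 q.2) (𝓝 1 ×ˢ 𝓝 0) (𝓝 1) := by
    have hc : Continuous fun q : ℝ × ℝ => (q.1 : ℂ) * 𝐞 q.2 := by fun_prop
    simpa [nhds_prod_eq] using hc.tendsto (1, 0)
  obtain ⟨pr, hpr, ps, hps, h⟩ := eventually_prod_iff.1 (hlim.eventually hp)
  obtain ⟨δ, hδ, hδs⟩ := Metric.eventually_nhds_iff.1 hps
  refine ⟨min δ 1, by positivity, min_le_right _ _, ?_⟩
  filter_upwards [mem_nhdsWithin_of_mem_nhds hpr, self_mem_nhdsWithin,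
    mem_nhdsWithin_of_mem_nhds (lt_mem_nhds one_pos)] with r hr hr1 hr0 s hs
  refine h hr (hδs (by simpa using hs.trans_le (min_le_left _ _))) ?_
  rw [norm_mul, Circle.norm_coe, mul_one, Complex.norm_real, Real.norm_of_nonneg (le_of_lt hr0)]
  exact hr1

-- The convolution of `S` with the Fourier coefficients of a localizer `Φ` is a Fourier integral of
-- the boundary values of `∑ S k z ^ k`, so Riemann–Lebesgue applies; slow variation of `S` makes
-- the convolution asymptotic to `S` itself.
theorem tendsto_zero_of_tendsto_succ_sub (hS : Tendsto (fun k => S (k + 1) - S k) atTop (𝓝 0))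
    {H : ℂ → ℂ} (hH : Continuous H)
    (hSH : ∀ᶠ z in 𝓝 (1 : ℂ), ‖z‖ < 1 → ∑' k, S k * z ^ k = H z) :
    Tendsto S atTop (𝓝 0) := by
  obtain ⟨M, hM0, hM⟩ : ∃ M, ‖S 0‖ ≤ M ∧ ∀ k, ‖S (k + 1) - S k‖ ≤ M := by
    obtain ⟨M, hM⟩ := hS.norm.bddAbove_range
    exact ⟨max ‖S 0‖ M, le_max_left _ _, fun k => (hM ⟨k, rfl⟩).trans (le_max_right _ _)⟩
  obtain ⟨δ, hδ, hδ1, hδH⟩ := exists_forall_abs_lt_of_eventually_nhds_one hSH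
  obtain ⟨Φ, hΦ, hΦ1⟩ := exists_schwartz_tsum_fourier_eq_one hδ hδ1
  set Λ : ℤ → ℂ := fun j => 𝓕 (Φ : ℝ → ℂ) j
  have hΛ : Summable fun j : ℤ => (1 + |(j : ℝ)|) * ‖Λ j‖ := by
    simpa only [SchwartzMap.fourier_coe] using summable_one_add_abs_mul_norm_schwartz (𝓕 Φ)
  have hdiff := norm_extendByZero_succ_sub_le hM0 hM
  have hsum (N : ℤ) : Summable fun k : ℕ => S k * Λ (N - k) := by
    have h := (summable_mul_of_norm_succ_sub_le hdiff hΛ N).comp_injective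
      (i := fun k : ℕ => N - k) (sub_right_injective.comp Nat.cast_injective)
    simpa only [Function.comp_def, sub_sub_cancel, extendByZero_natCast] using h
  have hRL : Tendsto (fun N : ℕ => ∑' j, extendByZero S (N - j) * Λ j) atTop (𝓝 0) := by
    refine ((Real.tendsto_integral_exp_smul_cocompact fun s => Φ s * H (𝐞 s)).comp
      ((tendsto_natCast_atTop_atTop (R := ℝ)).mono_right atTop_le_cocompact)).congr fun N => ?_
    rw [← tsum_mul_sub_natCast_eq_tsum_extendByZero]
    exact (tsum_mul_fourier_eq_integral (.of_norm_succ_sub_le hM0 hM) Φ.continuous hΦ hH hδH N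
      (hsum N)).symm
  have hconv := (tendsto_sub_tsum_mul_of_tendsto_succ_sub hdiff
    (tendsto_extendByZero_succ_sub hS) hΛ hΦ1).comp tendsto_natCast_atTop_atTop
  simpa [Function.comp_def, extendByZero_natCast] using hconv.add hRL

end BoundaryBehaviour

theorem hasSum_sum_range_succ_mul {e : ℕ → ℂ} {z : ℂ} (he : Summable fun k => ‖e k * z ^ k‖)
    (hz : ‖z‖ < 1) :
    HasSum (fun k => (∑ i ∈ Finset.range (k + 1), e i) * z ^ k)
      ((∑' k, e k * z ^ k) * (1 - z)⁻¹) := by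
  have h := hasSum_sum_range_mul_of_summable_norm he (summable_norm_geometric_of_norm_lt_one hz)
  rw [tsum_geometric_of_norm_lt_one hz] at h
  refine h.congr_fun fun k => ?_
  rw [Finset.sum_mul]
  refine Finset.sum_congr rfl fun i hi => ?_
  rw [mul_assoc, ← pow_add, Nat.add_sub_cancel' (Nat.lt_succ_iff.1 (Finset.mem_range.1 hi))]

theorem exists_continuous_eventuallyEq {X : Type*} [PseudoMetricSpace X] {f : X → ℂ} {c : X}
    (hf : ∀ᶠ z in 𝓝 c, ContinuousAt f z) :
    ∃ H : X → ℂ, Continuous H ∧ H =ᶠ[𝓝 c] f := by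
  obtain ⟨ε, hε, hball⟩ := Metric.nhds_basis_closedBall.mem_iff.1 hf
  obtain ⟨H, hH⟩ := ContinuousMap.exists_restrict_eq Metric.isClosed_closedBall
    ⟨_, continuousOn_iff_continuous_domRestrict.1
      (continuousOn_of_forall_continuousAt fun z hz => hball hz)⟩
  refine ⟨H, H.continuous, ?_⟩
  filter_upwards [Metric.closedBall_mem_nhds c hε] with z hz
  exact DFunLike.congr_fun hH ⟨z, hz⟩

theorem tendsto_sum_range_of_analyticAt_one {e : ℕ → ℂ} (he : Tendsto e atTop (𝓝 0)) {G : ℂ → ℂ}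
    (hG : AnalyticAt ℂ G 1)
    (hsum : ∀ᶠ z in 𝓝 (1 : ℂ), ‖z‖ < 1 → ∑' k, e k * z ^ k = G z) :
    Tendsto (fun N => ∑ i ∈ Finset.range N, e i) atTop (𝓝 (G 1)) := by
  have hslope : AnalyticAt ℂ (dslope G 1) 1 := by
    obtain ⟨p, hp⟩ := hG
    exact ⟨_, hp.has_fpower_series_dslope_fslope⟩
  obtain ⟨H, hHcont, hH⟩ := exists_continuous_eventuallyEq
    (hslope.eventually_analyticAt.mono fun z hz => hz.neg.continuousAt)
  obtain ⟨C, hC⟩ := he.norm.bddAbove_range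
  have hdisc : SummableOnDisc e 1 := .of_norm_le_geometric (C := C) fun k => by
    simpa using hC ⟨k, rfl⟩
  have hzero : Tendsto (fun N => ∑ i ∈ Finset.range (N + 1), e i - G 1) atTop (𝓝 0) := by
    refine tendsto_zero_of_tendsto_succ_sub ?_ hHcont ?_
    · refine ((tendsto_add_atTop_iff_nat 1).2 he).congr fun k => ?_
      rw [sub_sub_sub_cancel_right, Finset.sum_range_succ _ (k + 1), add_sub_cancel_left]
    · filter_upwards [hsum, hH] with z hz hHz hz1
      have hz0 : z ≠ 1 := by
        rintro rfl
        simp at hz1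
      have h := (hasSum_sum_range_succ_mul (hdisc.summable_norm hz1) hz1).sub
        ((hasSum_geometric_of_norm_lt_one hz1).mul_left (G 1))
      simp only [← sub_mul] at h
      rw [h.tsum_eq, hHz, Pi.neg_apply, dslope_of_ne _ hz0, slope_def_field, hz hz1,
        ← neg_sub z 1, inv_neg, mul_neg, div_eq_mul_inv]
  rw [← tendsto_add_atTop_iff_nat 1]
  simpa using hzero.add_const (G 1)

end Fatou

section FractionalIntegral

theorem eqOn_iteratedDeriv_of_hasDerivAt {𝕜 E : Type*} [NontriviallyNormedField 𝕜]
    [NormedAddCommGroup E] [NormedSpace 𝕜 E] {F : ℕ → 𝕜 → E} {U : Set 𝕜} (hU : IsOpen U)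
    (hF : ∀ u ∈ U, ∀ k, HasDerivAt (F k) (F (k + 1) u) u) (k : ℕ) :
    Set.EqOn (iteratedDeriv k (F 0)) (F k) U := by
  induction k with
  | zero => exact fun u _ => congrFun iteratedDeriv_zero u
  | succ k ih =>
    intro u hu
    rw [iteratedDeriv_succ, (ih.eventuallyEq_of_mem (hU.mem_nhds hu)).deriv_eq]
    exact (hF u hu k).deriv

theorem contDiffOn_of_hasDerivAt {𝕜 E : Type*} [NontriviallyNormedField 𝕜]
    [NormedAddCommGroup E] [NormedSpace 𝕜 E] {F : ℕ → 𝕜 → E} {U : Set 𝕜} (hU : IsOpen U)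
    (hF : ∀ u ∈ U, ∀ k, HasDerivAt (F k) (F (k + 1) u) u) (n k : ℕ) :
    ContDiffOn 𝕜 n (F k) U := by
  induction n generalizing k with
  | zero => exact contDiffOn_zero.2 fun u hu => (hF u hu k).continuousAt.continuousWithinAt
  | succ n ih =>
    rw [Nat.cast_succ, contDiffOn_succ_iff_deriv_of_isOpen hU]
    refine ⟨fun u hu => (hF u hu k).differentiableAt.differentiableWithinAt, by simp,
      (ih (k + 1)).congr fun u hu => (hF u hu k).deriv⟩

theorem hasDerivAt_ofReal_cpow {y : ℝ} (hy : 0 < y) (γ : ℂ) :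
    HasDerivAt (fun y : ℝ => (y : ℂ) ^ γ) (γ * (y : ℂ) ^ (γ - 1)) y := by
  have h : HasDerivAt (fun z : ℂ => z ^ γ) (γ * (y : ℂ) ^ (γ - 1) * 1) y :=
    (hasDerivAt_id' (y : ℂ)).cpow_const (Complex.ofReal_mem_slitPlane.2 hy)
  simpa only [mul_one] using h.comp_ofReal

variable {β : ℂ} {f f' : ℝ → ℂ} {b y : ℝ}

theorem intervalIntegrable_ofReal_cpow_sub_one (hβ : 0 < β.re) (a c : ℝ) :
    IntervalIntegrable (fun v : ℝ => (v : ℂ) ^ (β - 1)) MeasureTheory.volume a c :=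
  intervalIntegral.intervalIntegrable_cpow' (by simpa using hβ)

theorem mul_one_sub_mem_Icc {v : ℝ} (hy : 0 ≤ y) (hv : v ∈ Set.Icc (0 : ℝ) 1) :
    y * (1 - v) ∈ Set.Icc 0 y :=
  ⟨mul_nonneg hy (sub_nonneg.2 hv.2), mul_le_of_le_one_right hy (sub_le_self _ hv.1)⟩

theorem continuousOn_comp_mul_one_sub (hf : ContinuousOn f (Set.Icc 0 y)) (hy : 0 ≤ y) :
    ContinuousOn (fun v => f (y * (1 - v))) (Set.uIcc 0 1) := by
  rw [Set.uIcc_of_le zero_le_one]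
  exact hf.comp (by fun_prop) fun v hv => mul_one_sub_mem_Icc hy hv

theorem hasDerivAt_comp_mul_one_sub {v : ℝ} (hf : HasDerivAt f (f' (y * (1 - v))) (y * (1 - v))) :
    HasDerivAt (fun v => f (y * (1 - v))) (-(y : ℂ) * f' (y * (1 - v))) v := by
  have h := hf.scomp v (((hasDerivAt_id v).const_sub 1).const_mul y)
  simpa [Function.comp_def, Complex.real_smul] using h

/-- The Riemann–Liouville integral of `f` at `y`, without the factor `1 / Γ(β)` and rescaled to the
unit interval by `t = y (1 - v)`. -/
noncomputable def scaledIntegral (β : ℂ) (f : ℝ → ℂ) (y : ℝ) : ℂ :=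
  ∫ v in (0 : ℝ)..1, f (y * (1 - v)) * (v : ℂ) ^ (β - 1)

theorem rlIntegral_eq_scaledIntegral (hβ : 0 < β.re) (f : ℝ → ℂ) (hy : 0 < y) :
    rlIntegral β f y = (y : ℂ) ^ β / Complex.Gamma β * scaledIntegral β f y := by
  have hβ0 : β ≠ 0 := by
    rintro rfl
    exact hβ.ne rfl
  have hyc : (y : ℂ) ≠ 0 := Complex.ofReal_ne_zero.2 hy.ne'
  have hsubst := intervalIntegral.smul_integral_comp_sub_mul (a := 0) (b := 1)
    (fun t : ℝ => f t * ((y - t : ℝ) : ℂ) ^ (β - 1)) y y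
  simp only [mul_one, mul_zero, sub_self, sub_zero] at hsubst
  have hscale : ∫ v in (0 : ℝ)..1, f (y - y * v) * ((y - (y - y * v) : ℝ) : ℂ) ^ (β - 1) =
      (y : ℂ) ^ (β - 1) * scaledIntegral β f y := by
    rw [scaledIntegral, ← intervalIntegral.integral_const_mul]
    refine intervalIntegral.integral_congr fun v hv => ?_
    rw [Set.uIcc_of_le zero_le_one] at hv
    rw [sub_sub_cancel, Complex.ofReal_mul, Complex.mul_cpow_ofReal_nonneg hy.le hv.1, mul_sub,
      mul_one]
    ring
  rw [rlIntegral, if_neg hβ0, ← hsubst, hscale, Complex.cpow_sub _ _ hyc, Complex.cpow_one,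
    Complex.real_smul]
  field_simp

theorem intervalIntegrable_comp_mul_one_sub_mul {w : ℝ → ℂ}
    (hw : IntervalIntegrable w MeasureTheory.volume 0 1) (hf : ContinuousOn f (Set.Icc 0 y))
    (hy : 0 ≤ y) :
    IntervalIntegrable (fun v => f (y * (1 - v)) * w v) MeasureTheory.volume 0 1 :=
  hw.continuousOn_mul (continuousOn_comp_mul_one_sub hf hy)

theorem hasDerivAt_integral_comp_mul_one_sub_mul {w : ℝ → ℂ}
    (hw : IntervalIntegrable w MeasureTheory.volume 0 1)
    (hf : ∀ u ∈ Set.Ico 0 b, HasDerivAt f (f' u) u) (hf' : ContinuousOn f' (Set.Ico 0 b))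
    (hy : y ∈ Set.Ioo 0 b) :
    HasDerivAt (fun y => ∫ v in (0 : ℝ)..1, f (y * (1 - v)) * w v)
      (∫ v in (0 : ℝ)..1, f' (y * (1 - v)) * (((1 - v : ℝ) : ℂ) * w v)) y := by
  obtain ⟨c, hyc, hcb⟩ := exists_between hy.2
  have hsub {z : ℝ} (hz : z ∈ Set.Ioo 0 c) : Set.Icc 0 z ⊆ Set.Ico 0 b :=
    fun u hu => ⟨hu.1, (hu.2.trans_lt hz.2).trans hcb⟩
  have hfc : ContinuousOn f (Set.Ico 0 b) :=
    fun u hu => (hf u hu).continuousAt.continuousWithinAt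
  obtain ⟨M, hM⟩ := (isCompact_Icc (a := (0 : ℝ)) (b := c)).exists_bound_of_continuousOn
    (hf'.mono fun u hu => ⟨hu.1, hu.2.trans_lt hcb⟩)
  have hw' : IntervalIntegrable (fun v => ((1 - v : ℝ) : ℂ) * w v) MeasureTheory.volume 0 1 :=
    hw.continuousOn_mul (by fun_prop)
  have hyc' : y ∈ Set.Ioo 0 c := ⟨hy.1, hyc⟩
  refine (intervalIntegral.hasDerivAt_integral_of_dominated_loc_of_deriv_le
    (F := fun z v => f (z * (1 - v)) * w v)
    (F' := fun z v => f' (z * (1 - v)) * (((1 - v : ℝ) : ℂ) * w v))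
    (s := Set.Ioo 0 c) (bound := fun v => M * ‖((1 - v : ℝ) : ℂ) * w v‖)
    (Ioo_mem_nhds hy.1 hyc) ?_ ?_ ?_ ?_ (hw'.norm.const_mul M) ?_).2
  · filter_upwards [Ioo_mem_nhds hy.1 hyc] with z hz
    exact (intervalIntegrable_comp_mul_one_sub_mul hw (hfc.mono (hsub hz))
      hz.1.le).def'.aestronglyMeasurable
  · exact intervalIntegrable_comp_mul_one_sub_mul hw (hfc.mono (hsub hyc')) hy.1.le
  · exact (intervalIntegrable_comp_mul_one_sub_mul hw' (hf'.mono (hsub hyc'))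
      hy.1.le).def'.aestronglyMeasurable
  all_goals
    refine .of_forall fun v hv z hz => ?_
    rw [Set.uIoc_of_le zero_le_one] at hv
    have hmem := mul_one_sub_mem_Icc hz.1.le (Set.Ioc_subset_Icc_self hv)
  · rw [norm_mul]
    gcongr
    exact hM _ ⟨hmem.1, hmem.2.trans hz.2.le⟩
  · have h := (hf _ (hsub hz hmem)).scomp z ((hasDerivAt_id z).mul_const (1 - v))
    refine (h.mul_const (w v)).congr_deriv ?_
    rw [one_mul, Complex.real_smul]
    ring

theorem hasDerivAt_scaledIntegral (hβ : 0 < β.re)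
    (hf : ∀ u ∈ Set.Ico 0 b, HasDerivAt f (f' u) u) (hf' : ContinuousOn f' (Set.Ico 0 b))
    (hy : y ∈ Set.Ioo 0 b) :
    HasDerivAt (scaledIntegral β f) (scaledIntegral β f' y - scaledIntegral (β + 1) f' y) y := by
  have hcont : ContinuousOn f' (Set.Icc 0 y) := hf'.mono (Set.Icc_subset_Ico_right hy.2)
  refine (hasDerivAt_integral_comp_mul_one_sub_mul (intervalIntegrable_ofReal_cpow_sub_one hβ 0 1)
    hf hf' hy).congr_deriv ?_
  rw [scaledIntegral, scaledIntegral, ← intervalIntegral.integral_sub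
    (intervalIntegrable_comp_mul_one_sub_mul (intervalIntegrable_ofReal_cpow_sub_one hβ 0 1)
      hcont hy.1.le)
    (intervalIntegrable_comp_mul_one_sub_mul
      (intervalIntegrable_ofReal_cpow_sub_one (by simpa using hβ.trans (lt_add_one _)) 0 1)
      hcont hy.1.le)]
  refine intervalIntegral.integral_congr_ae (.of_forall fun v hv => ?_)
  rw [Set.uIoc_of_le zero_le_one] at hv
  have hv0 : (v : ℂ) ≠ 0 := Complex.ofReal_ne_zero.2 hv.1.ne'
  rw [add_sub_cancel_right, ← mul_sub, Complex.cpow_sub _ _ hv0, Complex.cpow_one]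
  push_cast
  field_simp

theorem mul_scaledIntegral_eq (hβ : 0 < β.re)
    (hf : ∀ u ∈ Set.Ico 0 b, HasDerivAt f (f' u) u) (hf' : ContinuousOn f' (Set.Ico 0 b))
    (hy : y ∈ Set.Ioo 0 b) :
    β * scaledIntegral β f y = f 0 + y * scaledIntegral (β + 1) f' y := by
  have hβ0 : β ≠ 0 := by
    rintro rfl
    exact hβ.ne rfl
  have hIcc : Set.Icc 0 y ⊆ Set.Ico 0 b := Set.Icc_subset_Ico_right hy.2
  have hfc : ContinuousOn f (Set.Icc 0 y) :=
    fun u hu => (hf u (hIcc hu)).continuousAt.continuousWithinAt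
  have hparts := intervalIntegral.integral_mul_deriv_eq_deriv_mul_of_hasDerivAt
    (continuousOn_comp_mul_one_sub hfc hy.1.le)
    (Complex.continuous_ofReal_cpow_const hβ).continuousOn
    (fun v hv => hasDerivAt_comp_mul_one_sub (f' := f') (hf _ (hIcc (mul_one_sub_mem_Icc hy.1.le
      (by simpa using Set.Ioo_subset_Icc_self hv)))))
    (fun v hv => hasDerivAt_ofReal_cpow (by simpa using hv.1) β)
    ((continuousOn_comp_mul_one_sub (hf'.mono hIcc) hy.1.le).const_smul
      (-(y : ℂ))).intervalIntegrable
    ((intervalIntegrable_ofReal_cpow_sub_one hβ 0 1).const_mul β)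
  simp only [mul_left_comm _ β, mul_assoc, intervalIntegral.integral_const_mul] at hparts
  simp only [scaledIntegral, add_sub_cancel_right]
  rw [hparts]
  simp [Complex.zero_cpow hβ0]

theorem hasDerivAt_rlIntegral (hβ : 0 < β.re)
    (hf : ∀ u ∈ Set.Ico 0 b, HasDerivAt f (f' u) u) (hf' : ContinuousOn f' (Set.Ico 0 b))
    (hy : y ∈ Set.Ioo 0 b) :
    HasDerivAt (rlIntegral β f)
      (f 0 * (y : ℂ) ^ (β - 1) / Complex.Gamma β + rlIntegral β f' y) y := by
  have hyc : (y : ℂ) ≠ 0 := Complex.ofReal_ne_zero.2 hy.1.ne'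
  have heq : rlIntegral β f =ᶠ[𝓝 y]
      fun y : ℝ => (y : ℂ) ^ β / Complex.Gamma β * scaledIntegral β f y := by
    filter_upwards [lt_mem_nhds hy.1] with z hz
    exact rlIntegral_eq_scaledIntegral hβ f hz
  refine ((((hasDerivAt_ofReal_cpow hy.1 β).div_const (Complex.Gamma β)).mul
    (hasDerivAt_scaledIntegral hβ hf hf' hy)).congr_of_eventuallyEq heq).congr_deriv ?_
  have hpow : (y : ℂ) ^ β = (y : ℂ) ^ (β - 1) * y := by
    rw [Complex.cpow_sub _ _ hyc, Complex.cpow_one, div_mul_cancel₀ _ hyc]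
  rw [rlIntegral_eq_scaledIntegral hβ f' hy.1, hpow]
  linear_combination ((y : ℂ) ^ (β - 1) / Complex.Gamma β) * mul_scaledIntegral_eq hβ hf hf' hy

/-- The closed form `∑_{j < m} f⁽ʲ⁾(0) y ^ (β - m + j) / Γ(β - m + j + 1) + ₀I^β f⁽ᵐ⁾ (y)` of the
`m`-th derivative of `₀I^β f` at `y`, for `f` smooth up to the base point. -/
noncomputable def rlIntegralDeriv (β : ℂ) (f : ℝ → ℂ) (m : ℕ) (y : ℝ) : ℂ :=
  ∑ j ∈ Finset.range m,
      iteratedDeriv j f 0 * ((y : ℂ) ^ (β - m + j) / Complex.Gamma (β - m + j + 1)) +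
    rlIntegral β (iteratedDeriv m f) y

theorem hasDerivAt_rlIntegralDeriv (hβ : 0 < β.re) (hf : ∀ u ∈ Set.Ico 0 b, ContDiffAt ℝ ∞ f u)
    (hy : y ∈ Set.Ioo 0 b) (m : ℕ) :
    HasDerivAt (rlIntegralDeriv β f m) (rlIntegralDeriv β f (m + 1) y) y := by
  have hint := hasDerivAt_rlIntegral hβ (fun u hu => hasDerivAt_iteratedDeriv (hf u hu) m)
    (fun u hu =>
      (contDiffAt_iteratedDeriv (hf u hu) (m + 1)).continuousAt.continuousWithinAt) hy
  have hpow (j : ℕ) : HasDerivAt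
      (fun y : ℝ =>
        iteratedDeriv j f 0 * ((y : ℂ) ^ (β - m + j) / Complex.Gamma (β - m + j + 1)))
      (iteratedDeriv j f 0 *
        ((y : ℂ) ^ (β - (m + 1 : ℕ) + j) / Complex.Gamma (β - (m + 1 : ℕ) + j + 1))) y := by
    refine (((hasDerivAt_ofReal_cpow hy.1 _).div_const _).const_mul _).congr_deriv ?_
    rw [show β - ((m + 1 : ℕ) : ℂ) + j = β - m + j - 1 by push_cast; ring, sub_add_cancel,
      div_eq_mul_inv _ (Complex.Gamma (β - m + j)),
      Complex.one_div_Gamma_eq_self_mul_one_div_Gamma_add_one]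
    ring
  refine ((HasDerivAt.fun_sum fun j _ => hpow j).add hint).congr_deriv ?_
  rw [rlIntegralDeriv, Finset.sum_range_succ,
    show β - ((m + 1 : ℕ) : ℂ) + m = β - 1 by push_cast; ring, sub_add_cancel]
  ring

theorem rlIntegralDeriv_zero (β : ℂ) (f : ℝ → ℂ) : rlIntegralDeriv β f 0 = rlIntegral β f := by
  funext y
  simp [rlIntegralDeriv]

theorem rlIntegralDeriv_succ (β : ℂ) (f : ℝ → ℂ) (m : ℕ) (y : ℝ) :
    rlIntegralDeriv β f (m + 1) y =
      f 0 * ((y : ℂ) ^ (β - (m + 1 : ℕ)) / Complex.Gamma (β - (m + 1 : ℕ) + 1)) +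
        rlIntegralDeriv β (deriv f) m y := by
  have hshift (j : ℕ) : β - ((m + 1 : ℕ) : ℂ) + ((j + 1 : ℕ) : ℂ) = β - m + j := by
    push_cast
    ring
  simp only [rlIntegralDeriv, Finset.sum_range_succ', ← iteratedDeriv_succ', hshift,
    iteratedDeriv_zero, Nat.cast_zero, add_zero]
  ring

theorem contDiffAt_rlIntegral (hβ : 0 < β.re) (hf : ∀ u ∈ Set.Ico 0 b, ContDiffAt ℝ ∞ f u)
    (hy : y ∈ Set.Ioo 0 b) (n : ℕ) : ContDiffAt ℝ n (rlIntegral β f) y := by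
  rw [← rlIntegralDeriv_zero]
  exact (contDiffOn_of_hasDerivAt isOpen_Ioo
    (fun u hu k => hasDerivAt_rlIntegralDeriv hβ hf hu k) n 0).contDiffAt (isOpen_Ioo.mem_nhds hy)

theorem iteratedDeriv_rlIntegral (hβ : 0 < β.re) (hf : ∀ u ∈ Set.Ico 0 b, ContDiffAt ℝ ∞ f u)
    (hy : y ∈ Set.Ioo 0 b) (n : ℕ) :
    iteratedDeriv n (rlIntegral β f) y = rlIntegralDeriv β f n y := by
  rw [← rlIntegralDeriv_zero]
  exact eqOn_iteratedDeriv_of_hasDerivAt isOpen_Ioo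
    (fun u hu k => hasDerivAt_rlIntegralDeriv hβ hf hu k) n hy

end FractionalIntegral

section AbelLimit

variable {D : ℕ → ℂ} {β : ℂ} {f h : ℝ → ℂ} {b x s R : ℝ}

theorem norm_ofReal_lt_one (hs : s ∈ Set.Ioo (0 : ℝ) 1) : ‖(s : ℂ)‖ < 1 := by
  rw [Complex.norm_of_nonneg hs.1.le]
  exact hs.2

theorem natCast_add_ne_zero (hβ : 0 < β.re) (k : ℕ) : (k : ℂ) + β ≠ 0 := fun h0 => by
  have hre : (k : ℝ) + β.re = 0 := by simpa using congrArg Complex.re h0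
  linarith [k.cast_nonneg (α := ℝ)]

theorem cpow_mul_tsum_div_eq_integral (hβ : 0 < β.re) (hD : SummableOnDisc D 1)
    (hh : ContinuousOn h (Set.Icc 0 1))
    (hsum : ∀ v ∈ Set.Ioo (0 : ℝ) 1, ∑' k, D k * (v : ℂ) ^ k = h v)
    (hs : s ∈ Set.Ioo (0 : ℝ) 1) :
    (s : ℂ) ^ β * ∑' k, D k / (k + β) * (s : ℂ) ^ k =
      ∫ v in (0 : ℝ)..s, h v * (v : ℂ) ^ (β - 1) := by
  have hβ0 : β ≠ 0 := by simpa using natCast_add_ne_zero hβ 0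
  have hcont : ContinuousOn (fun v : ℝ => (v : ℂ) ^ β * ∑' k, D k / (k + β) * (v : ℂ) ^ k)
      (Set.Icc 0 s) := by
    refine (Complex.continuous_ofReal_cpow_const hβ).continuousOn.mul
      ((hD.div_natCast_add β).differentiableOn.continuousOn.comp
        Complex.continuous_ofReal.continuousOn fun v hv => mem_ball_zero_iff.2 ?_)
    rw [Complex.norm_of_nonneg hv.1]
    exact hv.2.trans_lt hs.2
  have hderiv : ∀ v ∈ Set.Ioo 0 s, HasDerivAt
      (fun v : ℝ => (v : ℂ) ^ β * ∑' k, D k / (k + β) * (v : ℂ) ^ k)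
      (h v * (v : ℂ) ^ (β - 1)) v := fun v hv => by
    have hv1 : v ∈ Set.Ioo (0 : ℝ) 1 := ⟨hv.1, hv.2.trans hs.2⟩
    rw [← hsum v hv1, mul_comm]
    exact (hD.hasDerivAt_cpow_mul_tsum_div (natCast_add_ne_zero hβ) (norm_ofReal_lt_one hv1)
      (Complex.ofReal_mem_slitPlane.2 hv.1)).comp_ofReal
  have hint : IntervalIntegrable (fun v : ℝ => h v * (v : ℂ) ^ (β - 1)) MeasureTheory.volume 0 s :=
    (intervalIntegrable_ofReal_cpow_sub_one hβ 0 s).continuousOn_mul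
      (hh.mono (by rw [Set.uIcc_of_le hs.1.le]; exact Set.Icc_subset_Icc_right hs.2.le))
  rw [intervalIntegral.integral_eq_sub_of_hasDerivAt_of_le hs.1.le hcont hderiv hint]
  simp [Complex.zero_cpow hβ0]

theorem tendsto_tsum_div_nhdsLT_one (hβ : 0 < β.re) (hD : SummableOnDisc D 1)
    (hh : ContinuousOn h (Set.Icc 0 1))
    (hsum : ∀ v ∈ Set.Ioo (0 : ℝ) 1, ∑' k, D k * (v : ℂ) ^ k = h v) :
    Tendsto (fun s : ℝ => ∑' k, D k / (k + β) * (s : ℂ) ^ k) (𝓝[<] 1)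
      (𝓝 (∫ v in (0 : ℝ)..1, h v * (v : ℂ) ^ (β - 1))) := by
  have hint : IntervalIntegrable (fun v : ℝ => h v * (v : ℂ) ^ (β - 1)) MeasureTheory.volume 0 1 :=
    (intervalIntegrable_ofReal_cpow_sub_one hβ 0 1).continuousOn_mul
      (by rwa [Set.uIcc_of_le zero_le_one])
  have hprim : Tendsto (fun s : ℝ => ∫ v in (0 : ℝ)..s, h v * (v : ℂ) ^ (β - 1)) (𝓝[<] 1)
      (𝓝 (∫ v in (0 : ℝ)..1, h v * (v : ℂ) ^ (β - 1))) := by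
    have hc := intervalIntegral.continuousOn_primitive_interval' hint Set.left_mem_uIcc
    rw [Set.uIcc_of_le zero_le_one] at hc
    exact (hc 1 (Set.right_mem_Icc.2 zero_le_one)).mono_left
      (nhdsWithin_le_of_mem (Icc_mem_nhdsLT zero_lt_one))
  have hpow : Tendsto (fun s : ℝ => (s : ℂ) ^ β) (𝓝[<] 1) (𝓝 1) := by
    simpa using (Complex.continuous_ofReal_cpow_const hβ).tendsto 1 |>.mono_left nhdsWithin_le_nhds
  refine (div_one (∫ v in (0 : ℝ)..1, h v * (v : ℂ) ^ (β - 1)) ▸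
    hprim.div hpow one_ne_zero).congr' ?_
  filter_upwards [Ioo_mem_nhdsLT one_pos] with s hs
  rw [Pi.div_apply, ← cpow_mul_tsum_div_eq_integral hβ hD hh hsum hs, mul_div_cancel_left₀]
  exact mt (Complex.cpow_eq_zero_iff _ _).1 (by simp [hs.1.ne'])

theorem tsum_deriv_coeff_eq_deriv_comp_mul_one_sub (hD : SummableOnDisc D 1) (hx : x ≠ 0)
    (hsum : ∀ v ∈ Set.Ioo (0 : ℝ) 1, ∑' k, D k * (v : ℂ) ^ k = f (x * (1 - v)))
    (hs : s ∈ Set.Ioo (0 : ℝ) 1) (hf : DifferentiableAt ℝ f (x * (1 - s))) :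
    ∑' k : ℕ, -(x : ℂ)⁻¹ * (((k : ℂ) + 1) * D (k + 1)) * (s : ℂ) ^ k = deriv f (x * (1 - s)) := by
  have hxc : (x : ℂ) ≠ 0 := Complex.ofReal_ne_zero.2 hx
  have heq : (fun v : ℝ => ∑' k, D k * (v : ℂ) ^ k) =ᶠ[𝓝 s] fun v => f (x * (1 - v)) :=
    (Set.EqOn.eventuallyEq_of_mem hsum (isOpen_Ioo.mem_nhds hs))
  have hderiv := (hD.hasDerivAt (norm_ofReal_lt_one hs)).comp_ofReal.unique
    ((hasDerivAt_comp_mul_one_sub hf.hasDerivAt).congr_of_eventuallyEq heq)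
  have htsum := ((hD.hasSum_deriv (norm_ofReal_lt_one hs)).mul_left (-(x : ℂ)⁻¹)).tsum_eq
  rw [hderiv] at htsum
  simp only [mul_assoc] at htsum ⊢
  rw [htsum]
  field_simp

theorem cpow_div_Gamma_mul_tsum_div_eq (hD : SummableOnDisc D R) {γ : ℂ}
    (hγ : ∀ k : ℕ, (k : ℂ) + γ ≠ 0) {a z : ℂ} (ha : a ≠ 0) (hz : ‖z‖ < R) :
    a ^ γ / Complex.Gamma γ * ∑' k, D k / (k + γ) * z ^ k =
      (∑' k, D k * z ^ k) * (a ^ γ / Complex.Gamma (γ + 1)) +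
      z * (a ^ (γ + 1) / Complex.Gamma (γ + 1) *
        ∑' k : ℕ, -a⁻¹ * (((k : ℂ) + 1) * D (k + 1)) / (k + (γ + 1)) * z ^ k) := by
  have hEuler := hD.mul_tsum_div_eq_sub hγ hz
  simp only [mul_div_assoc, mul_assoc] at hEuler
  simp only [mul_assoc, mul_div_assoc, tsum_mul_left]
  rw [Complex.cpow_add _ _ ha, Complex.cpow_one, div_eq_mul_inv _ (Complex.Gamma γ),
    Complex.one_div_Gamma_eq_self_mul_one_div_Gamma_add_one]
  generalize ∑' k : ℕ, ((k : ℂ) + 1) * (D (k + 1) / (k + (γ + 1)) * z ^ k) = T at hEuler ⊢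
  linear_combination (a ^ γ * (Complex.Gamma (γ + 1))⁻¹) * hEuler +
    (a ^ γ * (Complex.Gamma (γ + 1))⁻¹ * z * T) * mul_inv_cancel₀ ha

theorem tendsto_mul_tsum_div_rlIntegralDeriv (hβ : 0 < β.re) (hx : x ∈ Set.Ioo 0 b) (n : ℕ)
    (hf : ∀ u ∈ Set.Ico 0 b, ContDiffAt ℝ ∞ f u) (hD : SummableOnDisc D 1)
    (hsum : ∀ v ∈ Set.Ioo (0 : ℝ) 1, ∑' k, D k * (v : ℂ) ^ k = f (x * (1 - v)))
    (hne : ∀ k : ℕ, (k : ℂ) + (β - n) ≠ 0) :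
    Tendsto (fun s : ℝ => (x : ℂ) ^ (β - n) / Complex.Gamma (β - n) *
      ∑' k, D k / (k + (β - n)) * (s : ℂ) ^ k) (𝓝[<] 1) (𝓝 (rlIntegralDeriv β f n x)) := by
  have hxc : (x : ℂ) ≠ 0 := Complex.ofReal_ne_zero.2 hx.1.ne'
  have hmem {v : ℝ} (hv : v ∈ Set.Icc (0 : ℝ) 1) : x * (1 - v) ∈ Set.Ico 0 b :=
    Set.Icc_subset_Ico_right hx.2 (mul_one_sub_mem_Icc hx.1.le hv)
  have hcont {f : ℝ → ℂ} (hf : ∀ u ∈ Set.Ico 0 b, ContDiffAt ℝ ∞ f u) :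
      ContinuousOn (fun v => f (x * (1 - v))) (Set.Icc 0 1) := fun v hv =>
    (ContinuousAt.comp (f := fun v => x * (1 - v)) (hf _ (hmem hv)).continuousAt
      (by fun_prop)).continuousWithinAt
  induction n generalizing f D with
  | zero =>
    simp only [Nat.cast_zero, sub_zero]
    rw [rlIntegralDeriv_zero, rlIntegral_eq_scaledIntegral hβ f hx.1]
    exact (tendsto_tsum_div_nhdsLT_one hβ hD (hcont hf) hsum).const_mul _
  | succ n ih =>
    set γ : ℂ := β - (n + 1 : ℕ) with hγ
    have hγ1 : β - n = γ + 1 := by rw [hγ]; push_cast; ring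
    have hD' : SummableOnDisc (fun k : ℕ => -(x : ℂ)⁻¹ * (((k : ℂ) + 1) * D (k + 1))) 1 :=
      hD.succ_mul_shift.of_norm_le_mul fun k => (norm_mul _ _).le
    have hderiv := ih (fun u hu => by simpa using contDiffAt_iteratedDeriv (hf u hu) 1) hD'
      (fun v hv => tsum_deriv_coeff_eq_deriv_comp_mul_one_sub hD hx.1.ne' hsum hv
        ((hf _ (hmem (Set.Ioo_subset_Icc_self hv))).differentiableAt (by simp)))
      (fun k => by simpa [hγ1, add_assoc, add_comm] using hne (k + 1))
    have hvalue : Tendsto (fun s : ℝ => f (x * (1 - s))) (𝓝[<] 1) (𝓝 (f 0)) := by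
      have hc := hcont hf 1 (Set.right_mem_Icc.2 zero_le_one)
      simpa [ContinuousWithinAt] using hc.mono_left
        (nhdsWithin_le_of_mem (Icc_mem_nhdsLT zero_lt_one))
    rw [rlIntegralDeriv_succ, ← hγ]
    have hs1 : Tendsto (fun s : ℝ => (s : ℂ)) (𝓝[<] 1) (𝓝 1) :=
      (Complex.continuous_ofReal.tendsto' 1 1 (by simp)).mono_left nhdsWithin_le_nhds
    refine ((hvalue.mul_const _).add (one_mul (rlIntegralDeriv β (deriv f) n x) ▸
      hs1.mul hderiv)).congr' ?_
    filter_upwards [Ioo_mem_nhdsLT one_pos] with s hs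
    rw [cpow_div_Gamma_mul_tsum_div_eq hD hne hxc (norm_ofReal_lt_one hs), hsum s hs, hγ1]

end AbelLimit

section AnalyticContinuation

open scoped Nat

variable {f : ℝ → ℂ} {r s t x b : ℝ} {S : Set ℝ} {A F Φ : ℂ → ℂ} {D : ℕ → ℂ}

/-- The sum at the complex point `z` of the Taylor series at `t` of a function of a real
variable. -/
noncomputable def taylorSum (f : ℝ → ℂ) (t : ℝ) (z : ℂ) : ℂ :=
  ∑' k : ℕ, iteratedDeriv k f t / k ! * (z - t) ^ k

theorem CauchyBoundOn.summableOnDisc (h : CauchyBoundOn f r S) (ht : t ∈ S) :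
    SummableOnDisc (fun k => iteratedDeriv k f t / k !) r := by
  obtain ⟨C, hC⟩ := h
  refine .of_norm_le_geometric (C := C) fun k => ?_
  rw [norm_div, Complex.norm_natCast, div_le_iff₀ (by positivity), inv_pow]
  exact (hC t ht k).trans_eq (by ring)

theorem CauchyBoundOn.differentiableOn_taylorSum (h : CauchyBoundOn f r S) (ht : t ∈ S) :
    DifferentiableOn ℂ (taylorSum f t) (Metric.ball (t : ℂ) r) :=
  (h.summableOnDisc ht).differentiableOn.comp (by fun_prop) fun _ hz =>
    mem_ball_zero_iff.2 (mem_ball_iff_norm.1 hz)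

theorem CauchyBoundOn.taylorSum_eq (hr : 0 < r) (h : CauchyBoundOn f r (Set.uIcc t s))
    (hf : ∀ u ∈ Set.uIcc t s, ContDiffAt ℝ ∞ f u) (hst : |s - t| < r) : taylorSum f t s = f s := by
  rw [← (h.hasSum_taylor hr hf hst).tsum_eq, taylorSum]
  refine tsum_congr fun k => ?_
  rw [Complex.real_smul]
  push_cast
  ring

theorem CauchyBoundOn.analyticAt (hr : 0 < r) (h : CauchyBoundOn f r S) (hS : S.OrdConnected)
    (hf : ∀ u ∈ S, ContDiffAt ℝ ∞ f u) (ht : S ∈ 𝓝 t) : AnalyticAt ℝ f t := by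
  have htS := mem_of_mem_nhds ht
  have hsum : AnalyticAt ℝ (fun s : ℝ => taylorSum f t s) t :=
    (((h.differentiableOn_taylorSum htS).analyticAt
      (Metric.ball_mem_nhds _ hr)).restrictScalars (𝕜 := ℝ)).comp (Complex.ofRealCLM.analyticAt t)
  refine hsum.congr ?_
  filter_upwards [ht, Metric.ball_mem_nhds t hr] with s hs hst
  have hsub := hS.uIcc_subset htS hs
  exact (h.mono hsub).taylorSum_eq hr (fun u hu => hf u (hsub hu)) hst

/-- The Taylor coefficients at `v = 0` of `v ↦ f (t - q v)`. -/
noncomputable def scaledTaylorCoeff (f : ℝ → ℂ) (q t : ℝ) (k : ℕ) : ℂ :=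
  (-q) ^ k * iteratedDeriv k f t / k !

theorem tsum_scaledTaylorCoeff (f : ℝ → ℂ) (q t : ℝ) (z : ℂ) :
    ∑' k, scaledTaylorCoeff f q t k * z ^ k = taylorSum f t (t - q * z) := by
  refine tsum_congr fun k => ?_
  rw [scaledTaylorCoeff, sub_sub_cancel_left, ← neg_mul, mul_pow]
  ring

theorem tsum_scaledTaylorCoeff_eq_comp_mul_one_sub (hx : 0 < x) (hr : 0 < r)
    (hf : ∀ u ∈ Set.Ioc 0 x, ContDiffAt ℝ ∞ f u)
    (hbound : ∀ a, 0 < a → CauchyBoundOn f r (Set.Icc a x))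
    (hD : SummableOnDisc (scaledTaylorCoeff f x x) 1) :
    ∀ v ∈ Set.Ioo (0 : ℝ) 1,
      ∑' k, scaledTaylorCoeff f x x k * (v : ℂ) ^ k = f (x * (1 - v)) := by
  have hmem {v : ℝ} (hv : v ∈ Set.Ioo (0 : ℝ) 1) : x * (1 - v) ∈ Set.Ioo 0 x :=
    ⟨mul_pos hx (sub_pos.2 hv.2), mul_lt_of_lt_one_right hx (sub_lt_self _ hv.1)⟩
  have hseries : AnalyticOnNhd ℝ (fun v : ℝ => ∑' k, scaledTaylorCoeff f x x k * (v : ℂ) ^ k)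
      (Set.Ioo 0 1) := fun v hv =>
    ((hD.differentiableOn.analyticAt (Metric.isOpen_ball.mem_nhds
      (mem_ball_zero_iff.2 (norm_ofReal_lt_one hv)))).restrictScalars (𝕜 := ℝ)).comp
      (Complex.ofRealCLM.analyticAt v)
  have hcomp : AnalyticOnNhd ℝ (fun v => f (x * (1 - v))) (Set.Ioo 0 1) := fun v hv => by
    refine AnalyticAt.comp (f := fun v => x * (1 - v)) ?_ (by fun_prop)
    have hpos := half_pos (hmem hv).1
    exact (hbound _ hpos).analyticAt hr Set.ordConnected_Icc
      (fun u hu => hf u ⟨hpos.trans_le hu.1, hu.2⟩)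
      (Icc_mem_nhds (half_lt_self (hmem hv).1) (hmem hv).2)
  obtain ⟨δ, hδ0, hδ⟩ := exists_between (lt_min one_pos (div_pos hr hx))
  rw [lt_min_iff] at hδ
  refine hseries.eqOn_of_preconnected_of_eventuallyEq hcomp isPreconnected_Ioo ⟨hδ0, hδ.1⟩ ?_
  filter_upwards [Ioo_mem_nhds hδ0 (lt_min hδ.1 hδ.2)] with v hv
  obtain ⟨hv1, hvr⟩ := lt_min_iff.1 hv.2
  have hpos := hmem ⟨hv.1, hv1⟩
  have hsub : Set.uIcc x (x * (1 - v)) ⊆ Set.Icc (x * (1 - v)) x := by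
    rw [Set.uIcc_of_ge hpos.2.le]
  have hdist : |x * (1 - v) - x| < r := by
    rw [abs_sub_comm, abs_of_pos (sub_pos.2 hpos.2), mul_one_sub, sub_sub_cancel]
    exact (lt_div_iff₀' hx).1 hvr
  rw [tsum_scaledTaylorCoeff, ← ((hbound _ hpos.1).mono hsub).taylorSum_eq hr
    (fun u hu => hf u ⟨hpos.1.trans_le (hsub hu).1, (hsub hu).2⟩) hdist]
  push_cast
  rw [mul_one_sub]

theorem eventually_eq_of_eventually_ofReal_eq (hF : DifferentiableOn ℂ F (Metric.ball 0 1))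
    (hΦ : AnalyticAt ℂ Φ 1) (heq : ∀ᶠ s : ℝ in 𝓝[<] 1, F s = Φ s) :
    ∀ᶠ z in 𝓝 (1 : ℂ), ‖z‖ < 1 → F z = Φ z := by
  obtain ⟨δ, hδ, hball⟩ := Metric.mem_nhds_iff.1 hΦ.eventually_analyticAt
  have hnear : ∀ᶠ s : ℝ in 𝓝[<] 1, (s : ℂ) ∈ Metric.ball (1 : ℂ) δ :=
    ((Complex.continuous_ofReal.tendsto' 1 1 (by simp)).mono_left nhdsWithin_le_nhds).eventually
      (Metric.ball_mem_nhds 1 hδ)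
  obtain ⟨s, hs, hsball, hseq⟩ := (Filter.Eventually.and (Ioo_mem_nhdsLT one_pos) (hnear.and
    (eventually_eventually_nhdsWithin.2 heq))).exists
  rw [isOpen_Iio.nhdsWithin_eq hs.2] at hseq
  have hofReal : Tendsto (fun w : ℝ => (w : ℂ)) (𝓝[≠] s) (𝓝[≠] (s : ℂ)) :=
    (hasDerivAt_id (s : ℂ)).comp_ofReal.tendsto_nhdsNE one_ne_zero
  have heqOn : Set.EqOn F Φ (Metric.ball 0 1 ∩ Metric.ball 1 δ) :=
    AnalyticOnNhd.eqOn_of_preconnected_of_frequently_eq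
      (fun z hz => hF.analyticAt (Metric.isOpen_ball.mem_nhds hz.1)) (fun z hz => hball hz.2)
      ((convex_ball _ _).inter (convex_ball _ _)).isPreconnected
      ⟨mem_ball_zero_iff.2 (norm_ofReal_lt_one hs), hsball⟩
      (hofReal.frequently (hseq.filter_mono nhdsWithin_le_nhds).frequently)
  filter_upwards [Metric.ball_mem_nhds 1 hδ] with z hz hz1
  exact heqOn ⟨mem_ball_zero_iff.2 hz1, hz⟩

/-- The power series `∑ D k * z ^ k` extends analytically from the unit disc to a neighbourhood of
the boundary point `1`. -/
def IsRegularAtOne (D : ℕ → ℂ) : Prop :=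
  ∃ Φ : ℂ → ℂ, AnalyticAt ℂ Φ 1 ∧ ∀ᶠ z in 𝓝 (1 : ℂ), ‖z‖ < 1 → ∑' k, D k * z ^ k = Φ z

theorem IsRegularAtOne.of_comp_mul_one_sub (hx : 0 < x) (hD : SummableOnDisc D 1)
    (hsum : ∀ v ∈ Set.Ioo (0 : ℝ) 1, ∑' k, D k * (v : ℂ) ^ k = f (x * (1 - v)))
    (hA : AnalyticAt ℂ A 0) (hAf : ∀ᶠ s : ℝ in 𝓝[>] 0, A s = f s) : IsRegularAtOne D := by
  have hΦ : AnalyticAt ℂ (fun z => A (x * (1 - z))) 1 :=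
    AnalyticAt.fun_comp (f := fun z : ℂ => x * (1 - z)) (by simpa using hA) (by fun_prop)
  refine ⟨_, hΦ, eventually_eq_of_eventually_ofReal_eq hD.differentiableOn hΦ ?_⟩
  have hmap : Tendsto (fun s : ℝ => x * (1 - s)) (𝓝[<] 1) (𝓝[>] 0) := by
    refine tendsto_nhdsWithin_iff.2 ⟨?_, ?_⟩
    · exact (Continuous.tendsto' (by fun_prop) 1 0 (by simp)).mono_left nhdsWithin_le_nhds
    · filter_upwards [self_mem_nhdsWithin] with s hs
      exact mul_pos hx (sub_pos.2 hs)
  filter_upwards [hmap.eventually hAf, Ioo_mem_nhdsLT one_pos] with s hs hs1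
  rw [hsum s hs1, ← hs]
  push_cast
  rfl

theorem IsRegularAtOne.div_natCast_add (h : IsRegularAtOne D) (hD : SummableOnDisc D 1) {γ : ℂ}
    (hγ : ∀ k : ℕ, (k : ℂ) + γ ≠ 0) : IsRegularAtOne fun k => D k / (k + γ) := by
  obtain ⟨Φ, hΦ, heq⟩ := h
  obtain ⟨δ, hδ, hball⟩ := Metric.mem_nhds_iff.1 (heq.and (hΦ.eventually_analyticAt.and
    (Complex.isOpen_slitPlane.mem_nhds Complex.one_mem_slitPlane)))
  have hcpow (c : ℂ) {z : ℂ} (hz : z ∈ Metric.ball (1 : ℂ) δ) :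
      DifferentiableAt ℂ (fun z : ℂ => z ^ c) z :=
    differentiableAt_id.cpow_const (hball hz).2.2
  obtain ⟨W, hW⟩ := DifferentiableOn.isExactOn_ball (c := 1) (r := δ)
    (f := fun z => z ^ (γ - 1) * Φ z) fun z hz =>
      ((hcpow _ hz).mul (hball hz).2.1.differentiableAt).differentiableWithinAt
  have hderiv : ∀ z ∈ Metric.ball (0 : ℂ) 1 ∩ Metric.ball 1 δ,
      HasDerivAt (fun z => z ^ γ * ∑' k, D k / (k + γ) * z ^ k - W z) 0 z := by
    rintro z ⟨hz1, hz⟩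
    rw [mem_ball_zero_iff] at hz1
    refine ((hD.hasDerivAt_cpow_mul_tsum_div hγ hz1 (hball hz).2.2).sub (hW z hz)).congr_deriv ?_
    rw [(hball hz).1 hz1, sub_self]
  obtain ⟨c, hc⟩ := (Metric.isOpen_ball.inter Metric.isOpen_ball).exists_is_const_of_deriv_eq_zero
    ((convex_ball _ _).inter (convex_ball _ _)).isPreconnected
    (fun z hz => (hderiv z hz).differentiableAt.differentiableWithinAt)
    (fun z hz => (hderiv z hz).deriv)
  refine ⟨fun z => z ^ (-γ) * (W z + c), ?_, ?_⟩
  · exact DifferentiableOn.analyticAt (s := Metric.ball 1 δ) (fun z hz =>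
      ((hcpow _ hz).mul ((hW z hz).differentiableAt.add_const c)).differentiableWithinAt)
      (Metric.ball_mem_nhds 1 hδ)
  · filter_upwards [Metric.ball_mem_nhds 1 hδ] with z hz hz1
    rw [← hc z ⟨mem_ball_zero_iff.2 hz1, hz⟩, add_sub_cancel, ← mul_assoc,
      ← Complex.cpow_add _ _ (Complex.slitPlane_ne_zero (hball hz).2.2), neg_add_cancel,
      Complex.cpow_zero, one_mul]

theorem exists_analyticAt_zero_eventually_eq (hx : 0 < x) (hr : 0 < r)
    (hf : ∀ u ∈ Set.Ioc 0 x, ContDiffAt ℝ ∞ f u)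
    (hbound : ∀ a, 0 < a → CauchyBoundOn f r (Set.Icc a x)) :
    ∃ A : ℂ → ℂ, AnalyticAt ℂ A 0 ∧ ∀ᶠ s : ℝ in 𝓝[>] 0, A s = f s := by
  obtain ⟨t, ht0, ht⟩ := exists_between (lt_min hx hr)
  rw [lt_min_iff] at ht
  have htx : t ∈ Set.Icc t x := ⟨le_rfl, ht.1.le⟩
  refine ⟨taylorSum f t, ((hbound t ht0).differentiableOn_taylorSum htx).analyticAt
    (Metric.isOpen_ball.mem_nhds ?_), ?_⟩
  · rw [Metric.mem_ball, dist_zero_left, Complex.norm_of_nonneg ht0.le]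
    exact ht.2
  · filter_upwards [Ioo_mem_nhdsGT ht0] with s hs
    have hsub : Set.uIcc t s ⊆ Set.Icc s x := by
      rw [Set.uIcc_of_ge hs.2.le]
      exact Set.Icc_subset_Icc_right ht.1.le
    refine ((hbound s hs.1).mono hsub).taylorSum_eq hr
      (fun u hu => hf u ⟨hs.1.trans_le (hsub hu).1, (hsub hu).2⟩) ?_
    rw [abs_sub_comm, abs_of_pos (sub_pos.2 hs.2)]
    linarith [hs.1, ht.2]

theorem exists_contDiffAt_extension (hf : ContDiffOn ℝ ∞ f (Set.Ioo 0 b)) (hA : AnalyticAt ℂ A 0)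
    (hAf : ∀ᶠ s : ℝ in 𝓝[>] 0, A s = f s) :
    ∃ g : ℝ → ℂ, (∀ t, 0 < t → g t = f t) ∧ ∀ u ∈ Set.Ico 0 b, ContDiffAt ℝ ∞ g u := by
  refine ⟨fun t => if 0 < t then f t else A t, fun t ht => if_pos ht, fun u hu => ?_⟩
  rcases hu.1.eq_or_lt with rfl | hu0
  · have hA0 : ContDiffAt ℝ ∞ (fun s : ℝ => A s) 0 :=
      ((AnalyticAt.restrictScalars (𝕜 := ℝ) (by simpa using hA)).comp
        (Complex.ofRealCLM.analyticAt 0)).contDiffAt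
    refine hA0.congr_of_eventuallyEq ?_
    filter_upwards [eventually_nhdsWithin_iff.1 hAf] with s hs
    split_ifs with hs0
    · exact (hs hs0).symm
    · rfl
  · refine (hf.contDiffAt (Ioo_mem_nhds hu0 hu.2)).congr_of_eventuallyEq ?_
    filter_upwards [lt_mem_nhds hu0] with s hs
    exact if_pos hs

end AnalyticContinuation

section Coefficients

open scoped Nat

variable {α : ℂ} {f : ℝ → ℂ} {x q ρ t : ℝ}

theorem succ_mul_choose_succ {R : Type*} [CommRing R] [BinomialRing R] (a : R) (k : ℕ) :
    (k + 1) * Ring.choose a (k + 1) = Ring.choose a k * (a - k) := by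
  simpa using Ring.choose_smul_choose a k.le_succ

theorem Gamma_neg_ne_zero (hα : ∀ m : ℕ, α ≠ m) : Complex.Gamma (-α) ≠ 0 :=
  Complex.Gamma_ne_zero fun m h => hα m (neg_injective h)

theorem natCast_add_neg_ne_zero (hα : ∀ m : ℕ, α ≠ m) (k : ℕ) : (k : ℂ) + -α ≠ 0 :=
  fun h => hα k (add_neg_eq_zero.1 h).symm

theorem Gamma_natCast_sub_ne_zero (hα : ∀ m : ℕ, α ≠ m) (k : ℕ) : Complex.Gamma (k - α) ≠ 0 := by
  refine Complex.Gamma_ne_zero fun m h => hα (k + m) ?_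
  push_cast
  linear_combination -h

theorem rlCoeff_succ (hα : ∀ m : ℕ, α ≠ m) (k : ℕ) :
    (k + 1) * (k + 1 - α) * rlCoeff α (k + 1) = -(k - α) * rlCoeff α k := by
  have hk := natCast_add_neg_ne_zero hα (k + 1)
  have hΓ := Gamma_natCast_sub_ne_zero hα (k + 1)
  have hchoose := succ_mul_choose_succ α k
  rw [← sub_eq_add_neg] at hk
  rw [rlCoeff, rlCoeff, Complex.Gamma_add_one _ hk]
  push_cast at hk hΓ ⊢
  rw [sub_add_eq_add_sub]
  field_simp
  linear_combination hchoose

theorem rlCoeff_eq (hα : ∀ m : ℕ, α ≠ m) (k : ℕ) :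
    rlCoeff α k = (Complex.Gamma (-α))⁻¹ * ((-1) ^ k / k ! / (k + -α)) := by
  induction k with
  | zero =>
    have hα0 : -α ≠ 0 := by simpa using hα 0
    simp [rlCoeff, Complex.Gamma_add_one _ hα0, mul_comm]
  | succ k ih =>
    have hk := natCast_add_neg_ne_zero hα k
    have hk1 := natCast_add_neg_ne_zero hα (k + 1)
    have hΓ := Gamma_neg_ne_zero hα
    have hrec := rlCoeff_succ hα k
    rw [ih] at hrec
    rw [Nat.factorial_succ, pow_succ]
    push_cast at hk1 ⊢
    rw [← sub_eq_add_neg] at hk hk1 hrec ⊢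
    field_simp at hrec ⊢
    linear_combination hrec

theorem rlCoeff_mul_pow_mul_iteratedDeriv (hα : ∀ m : ℕ, α ≠ m) (q t : ℝ) (f : ℝ → ℂ) (k : ℕ) :
    rlCoeff α k * (q : ℂ) ^ k * iteratedDeriv k f t =
      (Complex.Gamma (-α))⁻¹ * (scaledTaylorCoeff f q t k / (k + -α)) := by
  rw [rlCoeff_eq hα, scaledTaylorCoeff, neg_pow]
  ring

theorem rlTerm_eq (hα : ∀ m : ℕ, α ≠ m) (hx : x ≠ 0) (f : ℝ → ℂ) (k : ℕ) :
    rlTerm α f x k =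
      (x : ℂ) ^ (-α) / Complex.Gamma (-α) * (scaledTaylorCoeff f x x k / (k + -α)) := by
  rw [rlTerm, sub_eq_add_neg, Complex.cpow_add _ _ (Complex.ofReal_ne_zero.2 hx),
    Complex.cpow_natCast, ← mul_assoc, mul_right_comm, rlCoeff_mul_pow_mul_iteratedDeriv hα]
  ring

theorem exists_norm_le_of_tendsto_div_natCast_add {D : ℕ → ℂ} {γ : ℂ}
    (hγ : ∀ k : ℕ, (k : ℂ) + γ ≠ 0) (h : Tendsto (fun k => D k / (k + γ)) atTop (𝓝 0)) :
    ∃ C : ℝ, ∀ k : ℕ, ‖D k‖ ≤ C * (k + 1) := by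
  obtain ⟨M, hM⟩ := h.norm.bddAbove_range
  refine ⟨M * (1 + ‖γ‖), fun k => ?_⟩
  have hMk : ‖D k / (k + γ)‖ ≤ M := hM ⟨k, rfl⟩
  have hM0 : 0 ≤ M := (norm_nonneg _).trans hMk
  have hkγ : ‖(k : ℂ) + γ‖ ≤ (1 + ‖γ‖) * (k + 1) := by
    have hle := norm_add_le (k : ℂ) γ
    rw [Complex.norm_natCast] at hle
    nlinarith [norm_nonneg γ, mul_nonneg (norm_nonneg γ) k.cast_nonneg]
  calc ‖D k‖ = ‖D k / (k + γ)‖ * ‖(k : ℂ) + γ‖ := by rw [← norm_mul, div_mul_cancel₀ _ (hγ k)]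
    _ ≤ M * ((1 + ‖γ‖) * (k + 1)) := by gcongr
    _ = M * (1 + ‖γ‖) * (k + 1) := by ring

theorem exists_norm_scaledTaylorCoeff_le (hα : ∀ m : ℕ, α ≠ m)
    (h : Tendsto (fun k => rlCoeff α k * (q : ℂ) ^ k * iteratedDeriv k f t) atTop (𝓝 0)) :
    ∃ C : ℝ, ∀ k : ℕ, ‖scaledTaylorCoeff f q t k‖ ≤ C * (k + 1) := by
  refine exists_norm_le_of_tendsto_div_natCast_add (natCast_add_neg_ne_zero hα) ?_
  simp only [rlCoeff_mul_pow_mul_iteratedDeriv hα] at h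
  simpa [Gamma_neg_ne_zero hα] using h.const_mul (Complex.Gamma (-α))

theorem exists_norm_iteratedDeriv_le_of_tendsto (hα : ∀ m : ℕ, α ≠ m) (hρ : 0 < ρ)
    (h : Tendsto (fun k => rlCoeff α k * (ρ : ℂ) ^ k * iteratedDeriv k f t) atTop (𝓝 0)) :
    ∃ C : ℝ, ∀ k : ℕ, ‖iteratedDeriv k f t‖ ≤ C * (k ! / (ρ / 2) ^ k) := by
  obtain ⟨C, hC⟩ := exists_norm_scaledTaylorCoeff_le hα h
  have hC0 : 0 ≤ C := by simpa using (norm_nonneg _).trans (hC 0)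
  refine ⟨C, fun k => ?_⟩
  have hk := hC k
  rw [scaledTaylorCoeff, norm_div, norm_mul, norm_pow, norm_neg, Complex.norm_of_nonneg hρ.le,
    Complex.norm_natCast, div_le_iff₀ (by positivity), ← le_div_iff₀' (by positivity)] at hk
  have hpow : (k : ℝ) + 1 ≤ 2 ^ k := by exact_mod_cast Nat.lt_two_pow_self
  calc ‖iteratedDeriv k f t‖ ≤ C * (k + 1) * k ! / ρ ^ k := hk
    _ ≤ C * 2 ^ k * k ! / ρ ^ k := by gcongr
    _ = C * (k ! / (ρ / 2) ^ k) := by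
      rw [div_pow]
      field_simp

theorem cauchyBoundOn_Icc_of_tendsto (hα : ∀ m : ℕ, α ≠ m) (hρ : 0 < ρ)
    (hf : ∀ u ∈ Set.Ioc 0 x, ContDiffAt ℝ ∞ f u)
    (h : ∀ t ∈ Set.Ioc 0 x,
      Tendsto (fun k => rlCoeff α k * (ρ : ℂ) ^ k * iteratedDeriv k f t) atTop (𝓝 0))
    (a : ℝ) (ha : 0 < a) : CauchyBoundOn f (ρ / 2 / 2) (Set.Icc a x) :=
  have hsub {t : ℝ} (ht : t ∈ Set.Icc a x) : t ∈ Set.Ioc 0 x := ⟨ha.trans_le ht.1, ht.2⟩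
  cauchyBoundOn_of_forall_exists isCompact_Icc Set.ordConnected_Icc (half_pos hρ)
    (fun u hu => hf u (hsub hu))
    fun t ht => exists_norm_iteratedDeriv_le_of_tendsto hα hρ (h t (hsub ht))

theorem tendsto_scaledTaylorCoeff_div (hα : ∀ m : ℕ, α ≠ m) (hx : x ≠ 0)
    (h : Tendsto (rlTerm α f x) atTop (𝓝 0)) :
    Tendsto (fun k : ℕ => scaledTaylorCoeff f x x k / (k + -α)) atTop (𝓝 0) := by
  have hc : (x : ℂ) ^ (-α) / Complex.Gamma (-α) ≠ 0 :=
    div_ne_zero (by simp [Complex.cpow_eq_zero_iff, hx]) (Gamma_neg_ne_zero hα)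
  have hlim := h.const_mul ((x : ℂ) ^ (-α) / Complex.Gamma (-α))⁻¹
  simpa only [rlTerm_eq hα hx, inv_mul_cancel_left₀ hc, mul_zero] using hlim

end Coefficients

section Derivative

variable {α : ℂ} {f g : ℝ → ℂ} {x b : ℝ}

theorem rlOrder_sub_re_pos (hα : ∀ m : ℕ, α ≠ m) : 0 < ((rlOrder α : ℂ) - α).re := by
  rw [Complex.sub_re, Complex.natCast_re, sub_pos, rlOrder]
  split_ifs with him hre
  · refine (Nat.le_ceil _).lt_of_ne fun h => hα ⌈α.re⌉₊ ?_
    exact Complex.ext (by simpa using h) (by simpa using him)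
  · simpa using hre
  · push_cast
    exact Nat.lt_floor_add_one _

theorem rlIntegral_zero (f : ℝ → ℂ) : rlIntegral 0 f = f :=
  funext fun _ => if_pos rfl

theorem rlOrder_natCast (m : ℕ) : rlOrder (m : ℂ) = m := by
  simp [rlOrder]

theorem rlCoeff_natCast (m k : ℕ) : rlCoeff (m : ℂ) k = if k = m then 1 else 0 := by
  rw [rlCoeff, Ring.choose_natCast]
  rcases lt_trichotomy k m with hlt | rfl | hgt
  · obtain ⟨d, rfl⟩ := Nat.exists_eq_add_of_lt hlt
    have hpole : (k : ℂ) - ((k + d + 1 : ℕ) : ℂ) + 1 = -(d : ℂ) := by push_cast; ring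
    rw [hpole, Complex.Gamma_neg_nat_eq_zero, div_zero, if_neg hlt.ne]
  · simp
  · rw [Nat.choose_eq_zero_of_lt hgt, if_neg hgt.ne', Nat.cast_zero, zero_div]

theorem rlTerm_natCast (m : ℕ) (f : ℝ → ℂ) (x : ℝ) (k : ℕ) :
    rlTerm m f x k = if k = m then iteratedDeriv m f x else 0 := by
  rw [rlTerm, rlCoeff_natCast]
  split_ifs with h
  · simp [h]
  · simp

theorem rlDeriv_natCast (m : ℕ) (f : ℝ → ℂ) (x : ℝ) : rlDeriv m f x = iteratedDeriv m f x := by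
  rw [rlDeriv, rlOrder_natCast, sub_self, rlIntegral_zero]

theorem rlDifferentiableAt_natCast (m : ℕ) (hf : ContDiffAt ℝ m f x) :
    RLDifferentiableAt m f x := by
  rw [RLDifferentiableAt, rlOrder_natCast, sub_self, rlIntegral_zero]
  exact ⟨fun h => absurd rfl h, hf⟩

theorem tendsto_sum_rlTerm_natCast (m : ℕ) (f : ℝ → ℂ) (x : ℝ) :
    Tendsto (fun N : ℕ => ∑ k ∈ Finset.range N, rlTerm m f x k) atTop (𝓝 (rlDeriv m f x)) := by
  have h := hasSum_ite_eq m (iteratedDeriv m f x)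
  simpa only [rlTerm_natCast, rlDeriv_natCast] using h.tendsto_sum_nat

theorem rlIntegral_congr {β : ℂ} {y : ℝ} (h : ∀ t, 0 < t → g t = f t) (hy : 0 < y) :
    rlIntegral β g y = rlIntegral β f y := by
  rw [rlIntegral, rlIntegral, h y hy]
  congr 2
  refine intervalIntegral.integral_congr_Ioo_of_le hy.le fun t ht => ?_
  simp only [h t ht.1]

theorem intervalIntegrable_mul_cpow_sub {β : ℂ} {y : ℝ} (hβ : 0 < β.re)
    (hf : ContinuousOn f (Set.uIcc 0 y)) :
    IntervalIntegrable (fun t : ℝ => f t * ((y - t : ℝ) : ℂ) ^ (β - 1))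
      MeasureTheory.volume 0 y := by
  have h := (intervalIntegrable_ofReal_cpow_sub_one hβ y 0).comp_sub_left y
  rw [sub_self, sub_zero] at h
  exact h.continuousOn_mul hf

theorem rlIntegral_eventuallyEq {β : ℂ} (hgf : ∀ t, 0 < t → g t = f t) (hx : 0 < x) :
    rlIntegral β f =ᶠ[𝓝 x] rlIntegral β g := by
  filter_upwards [lt_mem_nhds hx] with y hy
  exact (rlIntegral_congr hgf hy).symm

theorem rlDeriv_eq_rlIntegralDeriv (hα : ∀ m : ℕ, α ≠ m) (hgf : ∀ t, 0 < t → g t = f t)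
    (hg : ∀ u ∈ Set.Ico 0 b, ContDiffAt ℝ ∞ g u) (hx : x ∈ Set.Ioo 0 b) :
    rlDeriv α f x = rlIntegralDeriv (rlOrder α - α) g (rlOrder α) x := by
  rw [rlDeriv, (rlIntegral_eventuallyEq hgf hx.1).iteratedDeriv_eq,
    iteratedDeriv_rlIntegral (rlOrder_sub_re_pos hα) hg hx]

theorem rlDifferentiableAt_of_contDiffAt (hα : ∀ m : ℕ, α ≠ m) (hgf : ∀ t, 0 < t → g t = f t)
    (hg : ∀ u ∈ Set.Ico 0 b, ContDiffAt ℝ ∞ g u) (hx : x ∈ Set.Ioo 0 b) :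
    RLDifferentiableAt α f x := by
  have hβ := rlOrder_sub_re_pos hα
  refine ⟨fun _ => ?_, (contDiffAt_rlIntegral hβ hg hx _).congr_of_eventuallyEq
    (rlIntegral_eventuallyEq hgf hx.1)⟩
  filter_upwards [isOpen_Ioo.mem_nhds hx] with y hy
  have hcont : ContinuousOn g (Set.uIcc 0 y) := by
    rw [Set.uIcc_of_le hy.1.le]
    exact fun t ht => (hg t ⟨ht.1, ht.2.trans_lt hy.2⟩).continuousAt.continuousWithinAt
  refine (intervalIntegrable_mul_cpow_sub hβ hcont).congr fun t ht => ?_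
  rw [Set.uIoc_of_le hy.1.le] at ht
  simp only [hgf t ht.1]

theorem tendsto_sum_rlTerm (hα : ∀ m : ℕ, α ≠ m) (hgf : ∀ t, 0 < t → g t = f t)
    (hg : ∀ u ∈ Set.Ico 0 b, ContDiffAt ℝ ∞ g u) (hx : x ∈ Set.Ioo 0 b)
    (hD : SummableOnDisc (scaledTaylorCoeff f x x) 1)
    (hsum : ∀ v ∈ Set.Ioo (0 : ℝ) 1,
      ∑' k, scaledTaylorCoeff f x x k * (v : ℂ) ^ k = f (x * (1 - v)))
    (hreg : IsRegularAtOne (scaledTaylorCoeff f x x))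
    (hterm : Tendsto (rlTerm α f x) atTop (𝓝 0)) :
    Tendsto (fun N : ℕ => ∑ k ∈ Finset.range N, rlTerm α f x k) atTop (𝓝 (rlDeriv α f x)) := by
  have hne := natCast_add_neg_ne_zero hα
  have hβ : (rlOrder α - α : ℂ) - rlOrder α = -α := sub_sub_cancel_left _ _
  obtain ⟨G, hG, hGsum⟩ := hreg.div_natCast_add hD hne
  have hfatou := tendsto_sum_range_of_analyticAt_one
    (tendsto_scaledTaylorCoeff_div hα hx.1.ne' hterm) hG hGsum
  have habel := (tendsto_map'_iff.1
    (Complex.tendsto_tsum_powerSeries_nhdsWithin_lt hfatou)).const_mul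
      ((x : ℂ) ^ (-α) / Complex.Gamma (-α))
  have hvalue := tendsto_mul_tsum_div_rlIntegralDeriv (rlOrder_sub_re_pos hα) hx (rlOrder α) hg hD
    (fun v hv => by rw [hsum v hv, hgf _ (mul_pos hx.1 (sub_pos.2 hv.2))]) (by rwa [hβ])
  rw [hβ, ← rlDeriv_eq_rlIntegralDeriv hα hgf hg hx] at hvalue
  rw [tendsto_nhds_unique hvalue habel]
  simpa only [Finset.mul_sum, ← rlTerm_eq hα hx.1.ne'] using
    hfatou.const_mul ((x : ℂ) ^ (-α) / Complex.Gamma (-α))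

end Derivative

theorem mainTheorem5 (α : ℂ) (f : ℝ → ℂ) (b x ρ : ℝ)
    (hx : 0 < x) (hxb : x < b) (hρ : 0 < ρ)
    (hf : ContDiffOn ℝ ∞ f (Set.Ioo 0 b))
    (hclass : ∀ t ∈ Set.Ioc 0 x,
      Tendsto (fun n : ℕ => rlCoeff α n * (ρ : ℂ) ^ n * iteratedDeriv n f t) atTop (𝓝 0))
    (hterm : Tendsto (rlTerm α f x) atTop (𝓝 0)) :
    RLDifferentiableAt α f x ∧
      Tendsto (fun N : ℕ => ∑ k ∈ Finset.range N, rlTerm α f x k) atTop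
        (𝓝 (rlDeriv α f x)) := by
  have hfsmooth (u : ℝ) (hu : u ∈ Set.Ioc 0 x) : ContDiffAt ℝ ∞ f u :=
    hf.contDiffAt (Ioo_mem_nhds hu.1 (hu.2.trans_lt hxb))
  by_cases hα : ∃ m : ℕ, α = m
  · obtain ⟨m, rfl⟩ := hα
    exact ⟨rlDifferentiableAt_natCast m ((hfsmooth x ⟨hx, le_rfl⟩).of_le
      (by exact_mod_cast le_top)), tendsto_sum_rlTerm_natCast m f x⟩
  push Not at hα
  have hr : 0 < ρ / 2 / 2 := half_pos (half_pos hρ)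
  have hbound := cauchyBoundOn_Icc_of_tendsto hα hρ hfsmooth hclass
  obtain ⟨A, hA, hAf⟩ := exists_analyticAt_zero_eventually_eq hx hr hfsmooth hbound
  obtain ⟨g, hgf, hg⟩ := exists_contDiffAt_extension hf hA hAf
  obtain ⟨C, hC⟩ := exists_norm_le_of_tendsto_div_natCast_add (natCast_add_neg_ne_zero hα)
    (tendsto_scaledTaylorCoeff_div hα hx.ne' hterm)
  have hD := SummableOnDisc.of_norm_le_linear hC
  have hsum := tsum_scaledTaylorCoeff_eq_comp_mul_one_sub hx hr hfsmooth hbound hD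
  exact ⟨rlDifferentiableAt_of_contDiffAt hα hgf hg ⟨hx, hxb⟩,
    tendsto_sum_rlTerm hα hgf hg ⟨hx, hxb⟩ hD hsum (.of_comp_mul_one_sub hx hD hsum hA hAf) hterm⟩
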